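/- **Theorem 0.1.** Let $A$ be a finite-dimensional (unital, associative) algebra over an algebraically closed field $K$. Let $\mathrm{mod}\,A$ be the category of finitely generated right $A$-modules and let $\mathbb{D}=\mathrm{Hom}_K(-,K)$ be the standard duality, which exchanges left and right $A$-modules. Then the following are equivalent: 1. $A$ is Iwanaga–Gorenstein, that is, $\mathrm{id}_A A<\infty$ and $\mathrm{id}_{A^{\mathrm{op}}}A<\infty$, and moreover $\mathrm{id}_A A\le 1$; 2. every classical cotilting module in $\mathrm{mod}\,A$ is a classical tilting module; 3. $\mathbb{D}A$ is a $\tau$-rigid module in $\mathrm{mod}\,A$; 4. $A$ is a $\tau^{-1}$-rigid module in $\mathrm{mod}\,A$. Here $\mathrm{id}_A A$ and $\mathrm{id}_{A^{\mathrm{op}}}A$ are the injective dimensions of $A$ as a right and as a left module over itself, and $\mathrm{add}\,T$ is the class of direct summands of finite direct sums of copies of $T$. A module $T\in\mathrm{mod}\,A$ is *classical tilting* if $\mathrm{pd}_A T\le 1$, $\mathrm{Ext}^i_A(T,T)=0$ for all $i\ge 1$, and there is an exact sequence $0\to A\to T_0\to T_1\to 0$ with $T_0,T_1\in\mathrm{add}\,T$.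 Dually, $T$ is *classical cotilting* if $\mathrm{id}_A T\le 1$, $\mathrm{Ext}^i_A(T,T)=0$ for all $i\ge 1$, and there is an exact sequence $0\to T_1\to T_0\to \mathbb{D}A\to 0$ with $T_0,T_1\in\mathrm{add}\,T$. For a finitely generated (left or right) module $M$ with minimal projective presentation $P_1\to P_0\to M\to 0$, put $\mathrm{Tr}\,M=\mathrm{Coker}\bigl(\mathrm{Hom}_A(P_0,A)\to\mathrm{Hom}_A(P_1,A)\bigr)$, and for $M\in\mathrm{mod}\,A$ let $\tau M=\mathbb{D}\,\mathrm{Tr}\,M$ and $\tau^{-1}M=\mathrm{Tr}\,\mathbb{D}M$ be the Auslander–Reiten translations. The module $M$ is *$\tau$-rigid* if $\mathrm{Hom}_A(M,\tau M)=0$, and *$\tau^{-1}$-rigid* if $\mathrm{Hom}_A(\tau^{-1}M,M)=0$. -/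

import Mathlib

open CategoryTheory MulOpposite

universe u

namespace TauTilting

/-! A right module over a ring `A` is a `Module Aᵐᵒᵖ M`, a left module is a `Module A M`.
In particular `A` itself is the regular right module through the instance `Module Aᵐᵒᵖ A`. -/

/-! ### The standard duality -/

section Duality

/-- The standard dual `D M = Hom_K(M, K)`. It turns left `A`-modules into right `A`-modules
and right `A`-modules into left `A`-modules. -/
def StdDual (K M : Type u) [Field K] [AddCommGroup M] [Module K M] : Type u := M →ₗ[K] K

variable {K A M : Type u} [Field K] [Ring A] [Algebra K A] [AddCommGroup M] [Module K M]

instance : AddCommGroup (StdDual K M) := inferInstanceAs (AddCommGroup (M →ₗ[K] K))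

instance : Module K (StdDual K M) := inferInstanceAs (Module K (M →ₗ[K] K))

/-- The right action on the dual of a left module: `(f · a) m = f (a • m)`. -/
instance StdDual.rightModule [Module A M] [IsScalarTower K A M] :
    Module Aᵐᵒᵖ (StdDual K M) where
  smul a f := LinearMap.comp (show M →ₗ[K] K from f) (Algebra.lsmul K K M (unop a))
  one_smul f := LinearMap.ext fun m => congrArg (show M →ₗ[K] K from f) (one_smul A m)
  mul_smul a b f := LinearMap.ext fun m =>
    congrArg (show M →ₗ[K] K from f) (mul_smul (unop b) (unop a) m)
  smul_zero _ := LinearMap.zero_comp _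
  smul_add _ _ _ := LinearMap.add_comp _ _ _
  add_smul a b f := LinearMap.ext fun m =>
    (congrArg (show M →ₗ[K] K from f) (add_smul (unop a) (unop b) m)).trans (map_add _ _ _)
  zero_smul f := LinearMap.ext fun m =>
    (congrArg (show M →ₗ[K] K from f) (zero_smul A m)).trans (map_zero _)

/-- The left action on the dual of a right module: `(a • f) m = f (m · a)`. -/
instance StdDual.leftModule [Module Aᵐᵒᵖ M] [IsScalarTower K Aᵐᵒᵖ M] :
    Module A (StdDual K M) where
  smul a f := LinearMap.comp (show M →ₗ[K] K from f) (Algebra.lsmul K K M (op a))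
  one_smul f := LinearMap.ext fun m => congrArg (show M →ₗ[K] K from f) (one_smul Aᵐᵒᵖ m)
  mul_smul a b f := LinearMap.ext fun m =>
    congrArg (show M →ₗ[K] K from f) (mul_smul (op b) (op a) m)
  smul_zero _ := LinearMap.zero_comp _
  smul_add _ _ _ := LinearMap.add_comp _ _ _
  add_smul a b f := LinearMap.ext fun m =>
    (congrArg (show M →ₗ[K] K from f) (add_smul (op a) (op b) m)).trans (map_add _ _ _)
  zero_smul f := LinearMap.ext fun m =>
    (congrArg (show M →ₗ[K] K from f) (zero_smul Aᵐᵒᵖ m)).trans (map_zero _)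

theorem StdDual.right_smul_apply [Module A M] [IsScalarTower K A M]
    (a : Aᵐᵒᵖ) (f : StdDual K M) (m : M) :
    (show M →ₗ[K] K from a • f) m = (show M →ₗ[K] K from f) (unop a • m) := rfl

theorem StdDual.left_smul_apply [Module Aᵐᵒᵖ M] [IsScalarTower K Aᵐᵒᵖ M]
    (a : A) (f : StdDual K M) (m : M) :
    (show M →ₗ[K] K from a • f) m = (show M →ₗ[K] K from f) (op a • m) := rfl

instance [Module A M] [IsScalarTower K A M] : IsScalarTower K Aᵐᵒᵖ (StdDual K M) where
  smul_assoc k a f := LinearMap.ext fun m =>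
    (congrArg (show M →ₗ[K] K from f) (smul_assoc k (unop a) m)).trans (map_smul _ _ _)

instance [Module Aᵐᵒᵖ M] [IsScalarTower K Aᵐᵒᵖ M] : IsScalarTower K A (StdDual K M) where
  smul_assoc k a f := LinearMap.ext fun m =>
    (congrArg (show M →ₗ[K] K from f) (smul_assoc k (op a) m)).trans (map_smul _ _ _)

instance [Module.Finite K M] : Module.Finite K (StdDual K M) :=
  inferInstanceAs (Module.Finite K (M →ₗ[K] K))

end Duality

/-! ### Minimal projective presentations -/

section Presentation

/-- A submodule `N` is superfluous in `P` if `L + N = P` forces `L = P`. -/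
def IsSuperfluous {R P : Type u} [Ring R] [AddCommGroup P] [Module R P]
    (N : Submodule R P) : Prop :=
  ∀ L : Submodule R P, L ⊔ N = ⊤ → L = ⊤

/-- A projective cover `π : P → M` in the category of finitely generated modules. -/
structure IsProjCover {R P M : Type u} [Ring R] [AddCommGroup P] [Module R P]
    [AddCommGroup M] [Module R M] (π : P →ₗ[R] M) : Prop where
  finite : Module.Finite R P
  projective : Module.Projective R P
  surjective : Function.Surjective π
  superfluous : IsSuperfluous (LinearMap.ker π)

/-- A minimal projective presentation `P₁ → P₀ → M → 0`: `P₀ → M` is a projective cover, and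
`P₁ → P₀` is a projective cover of its kernel, followed by the inclusion. -/
structure MinProjPresentation (R M : Type u) [Ring R] [AddCommGroup M] [Module R M] where
  P₀ : ModuleCat.{u} R
  P₁ : ModuleCat.{u} R
  π₀ : P₀ →ₗ[R] M
  π₁ : P₁ →ₗ[R] LinearMap.ker π₀
  cover₀ : IsProjCover π₀
  cover₁ : IsProjCover π₁

/-- The differential `P₁ → P₀` of a minimal projective presentation. -/
def MinProjPresentation.d {R M : Type u} [Ring R] [AddCommGroup M] [Module R M]
    (p : MinProjPresentation R M) : p.P₁ →ₗ[R] p.P₀ :=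
  (LinearMap.ker p.π₀).subtype ∘ₗ p.π₁

theorem exists_projCover (R M : Type u) [Ring R] [IsArtinianRing R] [AddCommGroup M]
    [Module R M] [Module.Finite R M] :
    ∃ (P : ModuleCat.{u} R) (π : P →ₗ[R] M), IsProjCover π := by
  let S : Set ℕ∞ := {l | ∃ (P : ModuleCat.{u} R) (π : P →ₗ[R] M), Module.Finite R P ∧
    Module.Projective R P ∧ Function.Surjective π ∧ Module.length R P = l}
  have hS : S.Nonempty := by
    obtain ⟨n, f, hf⟩ := Module.Finite.exists_fin' R M
    exact ⟨_, ModuleCat.of R (Fin n → R), f, inferInstanceAs (Module.Finite R (Fin n → R)),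
      inferInstanceAs (Module.Projective R (Fin n → R)), hf, rfl⟩
  obtain ⟨P, π, hfin, hproj, hsurj, hlen⟩ := csInf_mem hS
  refine ⟨P, π, hfin, hproj, hsurj, fun L hL => ?_⟩
  have hLs : Function.Surjective (π ∘ₗ L.subtype) := by
    rw [← LinearMap.range_eq_top, LinearMap.range_comp, Submodule.range_subtype]
    have h := congrArg (Submodule.map π) hL
    rwa [Submodule.map_sup, (LinearMap.le_ker_iff_map).1 le_rfl, sup_bot_eq,
      Submodule.map_top, LinearMap.range_eq_top.2 hsurj] at h
  obtain ⟨h, hh⟩ := Module.projective_lifting_property (π ∘ₗ L.subtype) π hLs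
  let e : Module.End R P := L.subtype ∘ₗ h
  have he : ∀ x, π (e x) = π x := fun x => LinearMap.congr_fun hh x
  have hen : ∀ (n : ℕ) x, π ((e ^ n) x) = π x := by
    intro n
    induction n with
    | zero => intro x; simp
    | succ n ih => intro x; rw [pow_succ', Module.End.mul_apply, he, ih]
  obtain ⟨n, hn, hn1⟩ := (e.eventually_isCompl_ker_pow_range_pow.and
    (Filter.eventually_ge_atTop 1)).exists
  let Q : Submodule R P := LinearMap.range (e ^ n)
  have hQp : Module.Projective R Q :=
    Module.Projective.of_split Q.subtype (Q.projectionOnto _ hn.symm)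
      (LinearMap.ext fun x => Submodule.projectionOnto_apply_left hn.symm x)
  have hQs : Function.Surjective (π ∘ₗ Q.subtype) := fun m => by
    obtain ⟨x, rfl⟩ := hsurj m
    exact ⟨⟨(e ^ n) x, x, rfl⟩, hen n x⟩
  have hmem : Module.length R Q ∈ S :=
    ⟨ModuleCat.of R Q, π ∘ₗ Q.subtype, inferInstanceAs (Module.Finite R Q), hQp, hQs, rfl⟩
  have hle : Module.length R P ≤ Module.length R Q := hlen ▸ csInf_le' hmem
  have hQ : Q = ⊤ := by
    by_contra hne
    exact absurd hle (not_le.2 (Submodule.length_lt hne))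
  rw [eq_top_iff, ← hQ]
  rintro _ ⟨x, rfl⟩
  obtain ⟨k, rfl⟩ : ∃ k, n = k + 1 := ⟨n - 1, by omega⟩
  rw [pow_succ', Module.End.mul_apply]
  exact (h ((e ^ k) x)).2

instance nonempty_minProjPresentation (R M : Type u) [Ring R] [IsArtinianRing R]
    [AddCommGroup M] [Module R M] [Module.Finite R M] :
    Nonempty (MinProjPresentation R M) := by
  obtain ⟨P₀, π₀, h₀⟩ := exists_projCover R M
  have := h₀.finite
  obtain ⟨P₁, π₁, h₁⟩ := exists_projCover R (LinearMap.ker π₀)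
  exact ⟨⟨P₀, P₁, π₀, π₁, h₀, h₁⟩⟩

/-- A chosen minimal projective presentation of a finitely generated module (it is unique up
to isomorphism). -/
noncomputable def minPres (R M : Type u) [Ring R] [IsArtinianRing R]
    [AddCommGroup M] [Module R M] [Module.Finite R M] : MinProjPresentation R M :=
  Classical.choice inferInstance

end Presentation

/-! ### The Auslander-Reiten translations -/

section Translation

/-- The left module `Coker (Hom_A(P₀, A) → Hom_A(P₁, A))` attached to a minimal projective
presentation of a right module. -/
abbrev TrRightOf {A M : Type u} [Ring A] [AddCommGroup M] [Module Aᵐᵒᵖ M]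
    (p : MinProjPresentation Aᵐᵒᵖ M) : Type u :=
  (p.P₁ →ₗ[Aᵐᵒᵖ] A) ⧸ LinearMap.range (LinearMap.lcomp A A p.d)

/-- The right module `Coker (Hom_A(P₀, A) → Hom_A(P₁, A))` attached to a minimal projective
presentation of a left module. -/
abbrev TrLeftOf {A M : Type u} [Ring A] [AddCommGroup M] [Module A M]
    (p : MinProjPresentation A M) : Type u :=
  (p.P₁ →ₗ[A] A) ⧸ LinearMap.range (LinearMap.lcomp Aᵐᵒᵖ A p.d)

variable (K A M : Type u) [Field K] [Ring A] [Algebra K A] [Module.Finite K A] [AddCommGroup M]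

/-- The transpose of a finitely generated right module, a left module. -/
abbrev TrRight [Module Aᵐᵒᵖ M] [Module.Finite Aᵐᵒᵖ M] : Type u :=
  haveI : IsArtinianRing Aᵐᵒᵖ := IsArtinianRing.of_finite K Aᵐᵒᵖ
  TrRightOf (minPres Aᵐᵒᵖ M)

/-- The transpose of a finitely generated left module, a right module. -/
abbrev TrLeft [Module A M] [Module.Finite A M] : Type u :=
  haveI : IsArtinianRing A := IsArtinianRing.of_finite K A
  TrLeftOf (minPres A M)

/-- The Auslander-Reiten translation `τ M = D Tr M` of a right module. -/
abbrev Tau [Module Aᵐᵒᵖ M] [Module.Finite Aᵐᵒᵖ M] : Type u :=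
  StdDual K (TrRight K A M)

variable [Module K M]

instance StdDual.finite_left [Module Aᵐᵒᵖ M] [IsScalarTower K Aᵐᵒᵖ M] [Module.Finite Aᵐᵒᵖ M] :
    Module.Finite A (StdDual K M) :=
  haveI : Module.Finite K M := Module.Finite.trans Aᵐᵒᵖ M
  Module.Finite.of_restrictScalars_finite K A _

instance StdDual.finite_right [Module A M] [IsScalarTower K A M] [Module.Finite A M] :
    Module.Finite Aᵐᵒᵖ (StdDual K M) :=
  haveI : Module.Finite K M := Module.Finite.trans A M
  Module.Finite.of_restrictScalars_finite K Aᵐᵒᵖ _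

/-- The regular right module is finitely generated. -/
instance finite_regular (A : Type u) [Ring A] : Module.Finite Aᵐᵒᵖ A :=
  Module.Finite.of_surjective (LinearMap.toSpanSingleton Aᵐᵒᵖ A 1)
    fun a => ⟨op a, one_mul a⟩

/-- The inverse Auslander-Reiten translation `τ⁻¹ M = Tr D M` of a right module. -/
abbrev TauInv [Module Aᵐᵒᵖ M] [IsScalarTower K Aᵐᵒᵖ M] [Module.Finite Aᵐᵒᵖ M] : Type u :=
  TrLeft K A (StdDual K M)

/-- A right module `T` is `τ`-rigid if `Hom_A(T, τ T) = 0`. -/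
def IsTauRigid (K A T : Type u) [Field K] [Ring A] [Algebra K A] [Module.Finite K A]
    [AddCommGroup T] [Module Aᵐᵒᵖ T] [Module.Finite Aᵐᵒᵖ T] : Prop :=
  ∀ f : T →ₗ[Aᵐᵒᵖ] Tau K A T, f = 0

/-- A right module `T` is `τ⁻¹`-rigid if `Hom_A(τ⁻¹ T, T) = 0`. -/
def IsTauInvRigid (K A T : Type u) [Field K] [Ring A] [Algebra K A] [Module.Finite K A]
    [AddCommGroup T] [Module K T] [Module Aᵐᵒᵖ T] [IsScalarTower K Aᵐᵒᵖ T]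
    [Module.Finite Aᵐᵒᵖ T] : Prop :=
  ∀ f : TauInv K A T →ₗ[Aᵐᵒᵖ] T, f = 0

end Translation

/-! ### Classical tilting and cotilting modules, Iwanaga-Gorenstein algebras -/

section Tilting

/-- `X` lies in `add T`: it is a direct summand of a finite direct sum of copies of `T`. -/
def InAdd {R : Type u} [Ring R] (T X : ModuleCat.{u} R) : Prop :=
  ∃ (n : ℕ) (i : X →ₗ[R] (Fin n → T)) (r : (Fin n → T) →ₗ[R] X), r ∘ₗ i = LinearMap.id

/-- The right `A`-module `T` is classical tilting: `pd T ≤ 1`, `Ext^i(T, T) = 0` for all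
`i ≥ 1`, and there is an exact sequence `0 → A → T₀ → T₁ → 0` with `T₀, T₁` in `add T`. -/
structure IsClassicalTilting (A : Type u) [Ring A] (T : ModuleCat.{u} Aᵐᵒᵖ) : Prop where
  finite : Module.Finite Aᵐᵒᵖ T
  projDim_le : projectiveDimension T ≤ 1
  ext_eq_zero : ∀ i : ℕ, 1 ≤ i → Subsingleton (Abelian.Ext T T i)
  coresolution : ∃ (T₀ T₁ : ModuleCat.{u} Aᵐᵒᵖ) (f : A →ₗ[Aᵐᵒᵖ] T₀) (g : T₀ →ₗ[Aᵐᵒᵖ] T₁),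
    InAdd T T₀ ∧ InAdd T T₁ ∧
      Function.Injective f ∧ Function.Exact f g ∧ Function.Surjective g

/-- The right `A`-module `T` is classical cotilting: `id T ≤ 1`, `Ext^i(T, T) = 0` for all
`i ≥ 1`, and there is an exact sequence `0 → T₁ → T₀ → D A → 0` with `T₀, T₁` in `add T`. -/
structure IsClassicalCotilting (K A : Type u) [Field K] [Ring A] [Algebra K A]
    (T : ModuleCat.{u} Aᵐᵒᵖ) : Prop where
  finite : Module.Finite Aᵐᵒᵖ T
  injDim_le : injectiveDimension T ≤ 1
  ext_eq_zero : ∀ i : ℕ, 1 ≤ i → Subsingleton (Abelian.Ext T T i)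
  resolution : ∃ (T₀ T₁ : ModuleCat.{u} Aᵐᵒᵖ) (f : T₁ →ₗ[Aᵐᵒᵖ] T₀)
      (g : T₀ →ₗ[Aᵐᵒᵖ] StdDual K A),
    InAdd T T₀ ∧ InAdd T T₁ ∧
      Function.Injective f ∧ Function.Exact f g ∧ Function.Surjective g

/-- `A` is Iwanaga-Gorenstein: it has finite injective dimension as a right and as a left
module over itself. -/
def IsIwanagaGorenstein (A : Type u) [Ring A] : Prop :=
  injectiveDimension (ModuleCat.of Aᵐᵒᵖ A) < ⊤ ∧ injectiveDimension (ModuleCat.of A A) < ⊤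

end Tilting

end TauTilting

/-!
Write `D` for the standard duality and `U` for `A` as a bimodule. For a module `M` with minimal
presentation `d : P₁ → P₀`, the dual of `Tr M` is `Ker d` (`kerEquivHomCoker`). Hence `A` is
`τ⁻¹`-rigid if and only if the left module `D A` has projective dimension at most one
(`isTauInvRigid_regular_iff`) and, as `Hom(D A, D Tr D A) = Hom(Tr D A, A)`, the module `D A` is
`τ`-rigid if and only if the right module `D A` has projective dimension at most one
(`isTauRigid_dual_iff`). Dualizing a projective resolution of `D A`, these conditions give
`id A ≤ 1` on the right and on the left respectively. It remains to see that `id A ≤ 1` on one side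
forces `pd D A ≤ 1` on the same side; then everything holds on both sides.

This is a form of Bongartz's completion argument. Suppose `id U ≤ 1` for right modules, and write
`M* = Hom(M, U)`. The assignment `Z ↦ [Z*] - [Ext¹(Z, U)]` induces a homomorphism from the
Grothendieck group of right modules to that of left modules. Since submodules of `Uⁿ` are
`Ext`-orthogonal to `U`, it can be computed as `[Q*] - [K*]` from any resolution
`0 → K → Q → Z → 0` with `Q` torsionless, so no bimodule structure on `Ext¹` is needed. The
transposed map on rational additive functions (`eulerMap`) is injective: a function in the kernel
vanishes on all duals `Z*`, hence on free modules and on second syzygies, hence everywhere. By `D`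
the two Grothendieck groups have the same finite rank, so the map is bijective and the length of `Z`
is a function of `[Z*] - [Ext¹(Z, U)]`. In particular `Z* = 0 = Ext¹(Z, U)` forces `Z = 0`
(`subsingleton_of_hom_ext_eq_zero`). Applied to the torsion part of a module in the left orthogonal
of `U`, this shows that the orthogonal consists of torsionless modules, and the middle term of the
universal extension of `D A` by copies of `U` turns out to be projective
(`hasProjectiveDimensionLT_two_of_injective`).

For the cotilting condition, `D A` is always cotilting, so if cotilting modules are tilting then
`pd D A ≤ 1`. Conversely, if `id A ≤ 1` and `T` is cotilting, injective modules have projective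
dimension at most one, so `pd T ≤ 1`; left `T`-approximations `0 → A → Tᵐ → Q → 0` and
`0 → Q → Tʳ → Q' → 0` exist, and the second one splits because `Ext¹(Q', Q)` embeds into
`Ext²(Q', A) = 0`.
-/

namespace TauTilting

/-! ### Vanishing of extension groups between unbundled modules

Consequences of the long exact sequences of `Ext`; primed names refer to the covariant sequence,
unprimed ones to the contravariant sequence. -/

section Ext

open Abelian

/-- `Ext^n_R(M, N) = 0`, for unbundled modules. -/
abbrev ExtVanish (R M N : Type u) [Ring R] [AddCommGroup M] [Module R M] [AddCommGroup N]
    [Module R N] (n : ℕ) : Prop :=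
  Subsingleton (Ext (ModuleCat.of R M) (ModuleCat.of R N) n)

variable {R M N L Z : Type u} [Ring R] [AddCommGroup M] [Module R M] [AddCommGroup N]
  [Module R N] [AddCommGroup L] [Module R L] [AddCommGroup Z] [Module R Z]

/-- The categorical short complex of a pair of composable linear maps. -/
abbrev shortComplexOf (f : M →ₗ[R] N) (g : N →ₗ[R] L) (h : Function.Exact f g) :
    ShortComplex (ModuleCat.{u} R) :=
  ShortComplex.mk (ModuleCat.ofHom f) (ModuleCat.ofHom g)
    (by ext x; exact h.apply_apply_eq_zero x)

theorem shortExact_shortComplexOf {f : M →ₗ[R] N} {g : N →ₗ[R] L} (hf : Function.Injective f)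
    (h : Function.Exact f g) (hg : Function.Surjective g) :
    (shortComplexOf f g h).ShortExact where
  exact := (ShortComplex.ShortExact.moduleCat_exact_iff_function_exact _).2 h
  mono_f := (ModuleCat.mono_iff_injective _).2 hf
  epi_g := (ModuleCat.epi_iff_surjective _).2 hg

section Sequence

variable {f : M →ₗ[R] N} {g : N →ₗ[R] L} (hf : Function.Injective f)
  (h : Function.Exact f g) (hg : Function.Surjective g)

include hf h hg

theorem exists_extend_of_extVanish (hL : ExtVanish R L Z 1) (a : M →ₗ[R] Z) :
    ∃ b : N →ₗ[R] Z, b ∘ₗ f = a := by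
  obtain ⟨x, hx⟩ := Ext.contravariant_sequence_exact₁ (shortExact_shortComplexOf hf h hg)
    (ModuleCat.of R Z) (Ext.mk₀ (ModuleCat.ofHom a)) (n₁ := 1) rfl (hL.elim _ _)
  obtain ⟨b, rfl⟩ := (Ext.addEquiv₀.symm).surjective x
  refine ⟨b.hom, ?_⟩
  have : ModuleCat.ofHom f ≫ b = ModuleCat.ofHom a := by
    apply Ext.addEquiv₀.symm.injective
    simpa using hx
  exact congrArg ModuleCat.Hom.hom this

theorem exists_lift_of_extVanish (hM : ExtVanish R Z M 1) (a : Z →ₗ[R] L) :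
    ∃ b : Z →ₗ[R] N, g ∘ₗ b = a := by
  obtain ⟨x, hx⟩ := Ext.covariant_sequence_exact₃ (ModuleCat.of R Z)
    (shortExact_shortComplexOf hf h hg) (Ext.mk₀ (ModuleCat.ofHom a)) (n₁ := 1) rfl (hM.elim _ _)
  obtain ⟨b, rfl⟩ := (Ext.addEquiv₀.symm).surjective x
  refine ⟨b.hom, ?_⟩
  have : b ≫ ModuleCat.ofHom g = ModuleCat.ofHom a := by
    apply Ext.addEquiv₀.symm.injective
    simpa using hx
  exact congrArg ModuleCat.Hom.hom this

theorem extVanish_one_of_exists_extend (hN : ExtVanish R N Z 1)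
    (hex : ∀ a : M →ₗ[R] Z, ∃ b : N →ₗ[R] Z, b ∘ₗ f = a) : ExtVanish R L Z 1 := by
  refine subsingleton_of_forall_eq 0 fun x => ?_
  obtain ⟨y, rfl⟩ := Ext.contravariant_sequence_exact₃ (shortExact_shortComplexOf hf h hg)
    (ModuleCat.of R Z) x (hN.elim _ _) (n₀ := 0) rfl
  obtain ⟨a, rfl⟩ := (Ext.addEquiv₀.symm).surjective y
  obtain ⟨b, hb⟩ := hex a.hom
  have : a = ModuleCat.ofHom f ≫ ModuleCat.ofHom b := by
    ext x
    exact (LinearMap.congr_fun hb x).symm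
  subst this
  simpa using (shortExact_shortComplexOf hf h hg).extClass_comp_assoc
    (Ext.mk₀ (ModuleCat.ofHom b))

theorem extVanish_left (n : ℕ) (hN : ExtVanish R N Z n) (hL : ExtVanish R L Z (n + 1)) :
    ExtVanish R M Z n := by
  refine subsingleton_of_forall_eq 0 fun x => ?_
  obtain ⟨y, rfl⟩ := Ext.contravariant_sequence_exact₁ (shortExact_shortComplexOf hf h hg)
    (ModuleCat.of R Z) x (add_comm 1 n) (hL.elim _ _)
  rw [hN.elim y 0, Ext.comp_zero]

theorem extVanish_middle (n : ℕ) (hM : ExtVanish R M Z n) (hL : ExtVanish R L Z n) :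
    ExtVanish R N Z n := by
  refine subsingleton_of_forall_eq 0 fun x => ?_
  obtain ⟨y, rfl⟩ := Ext.contravariant_sequence_exact₂ (shortExact_shortComplexOf hf h hg)
    (ModuleCat.of R Z) x (hM.elim _ _)
  rw [hL.elim y 0, Ext.comp_zero]

theorem extVanish_middle' (n : ℕ) (hM : ExtVanish R Z M n) (hL : ExtVanish R Z L n) :
    ExtVanish R Z N n := by
  refine subsingleton_of_forall_eq 0 fun x => ?_
  obtain ⟨y, rfl⟩ := Ext.covariant_sequence_exact₂ (ModuleCat.of R Z)
    (shortExact_shortComplexOf hf h hg) x (hL.elim _ _)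
  rw [hM.elim y 0, Ext.zero_comp]

theorem extVanish_right' (n : ℕ) (hN : ExtVanish R Z N n) (hM : ExtVanish R Z M (n + 1)) :
    ExtVanish R Z L n := by
  refine subsingleton_of_forall_eq 0 fun x => ?_
  obtain ⟨y, rfl⟩ := Ext.covariant_sequence_exact₃ (ModuleCat.of R Z)
    (shortExact_shortComplexOf hf h hg) x rfl (hM.elim _ _)
  rw [hN.elim y 0, Ext.zero_comp]

end Sequence

theorem extVanish_of_projective [Module.Projective R M] (n : ℕ) : ExtVanish R M Z (n + 1) :=
  subsingleton_of_forall_eq 0 fun x => Ext.eq_zero_of_projective x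

theorem extVanish_of_injective [Module.Injective R Z] (n : ℕ) : ExtVanish R M Z (n + 1) :=
  haveI := Module.injective_object_of_injective_module R Z
  subsingleton_of_forall_eq 0 fun x => Ext.eq_zero_of_injective x

theorem extVanish_of_retract (n : ℕ) (i : M →ₗ[R] N) (r : N →ₗ[R] M)
    (hri : r ∘ₗ i = LinearMap.id) (hN : ExtVanish R N Z n) : ExtVanish R M Z n := by
  refine subsingleton_of_forall_eq 0 fun x => ?_
  have hid : ModuleCat.ofHom i ≫ ModuleCat.ofHom r = 𝟙 (ModuleCat.of R M) := by
    rw [← ModuleCat.ofHom_comp, hri]; rfl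
  rw [← Ext.mk₀_id_comp x, ← hid, ← Ext.mk₀_comp_mk₀_assoc,
    hN.elim ((Ext.mk₀ (ModuleCat.ofHom r)).comp x (zero_add n)) 0, Ext.comp_zero]

theorem extVanish_of_retract' (n : ℕ) (i : M →ₗ[R] N) (r : N →ₗ[R] M)
    (hri : r ∘ₗ i = LinearMap.id) (hN : ExtVanish R Z N n) : ExtVanish R Z M n := by
  refine subsingleton_of_forall_eq 0 fun x => ?_
  have hid : ModuleCat.ofHom i ≫ ModuleCat.ofHom r = 𝟙 (ModuleCat.of R M) := by
    rw [← ModuleCat.ofHom_comp, hri]; rfl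
  rw [← Ext.comp_mk₀_id x, ← hid, ← Ext.mk₀_comp_mk₀, ← Ext.comp_assoc_of_third_deg_zero,
    hN.elim (x.comp (Ext.mk₀ (ModuleCat.ofHom i)) (add_zero n)) 0, Ext.zero_comp]

/-- The sequence `0 → M → M^(n+1) → M^n → 0` splitting off the first coordinate. -/
theorem exact_single_zero_tail (M : Type u) [AddCommGroup M] [Module R M] (n : ℕ) :
    Function.Exact (LinearMap.single R (fun _ : Fin (n + 1) => M) 0)
      (LinearMap.funLeft R M (Fin.succ : Fin n → Fin (n + 1))) := by
  intro v
  constructor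
  · intro hv
    refine ⟨v 0, funext fun i => ?_⟩
    refine Fin.cases ?_ (fun j => ?_) i
    · simp
    · simpa using (congrFun hv j).symm
  · rintro ⟨x, rfl⟩
    ext j
    simp [LinearMap.funLeft]

theorem extVanish_pi (n : ℕ) (h : ExtVanish R M Z n) (k : ℕ) : ExtVanish R (Fin k → M) Z n := by
  induction k with
  | zero =>
    exact extVanish_of_retract n (0 : (Fin 0 → M) →ₗ[R] M) 0 (Subsingleton.elim _ _) h
  | succ k ih =>
    exact extVanish_middle (LinearMap.ker_eq_bot.1 (LinearMap.ker_single R (fun _ : Fin (k + 1) => M) 0))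
      (exact_single_zero_tail M k)
      (LinearMap.funLeft_surjective_of_injective R M _ (Fin.succ_injective k)) n h ih

theorem extVanish_pi' (n : ℕ) (h : ExtVanish R Z M n) (k : ℕ) : ExtVanish R Z (Fin k → M) n := by
  induction k with
  | zero =>
    exact extVanish_of_retract' n (0 : (Fin 0 → M) →ₗ[R] M) 0 (Subsingleton.elim _ _) h
  | succ k ih =>
    exact extVanish_middle' (LinearMap.ker_eq_bot.1 (LinearMap.ker_single R (fun _ : Fin (k + 1) => M) 0))
      (exact_single_zero_tail M k)
      (LinearMap.funLeft_surjective_of_injective R M _ (Fin.succ_injective k)) n h ih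

end Ext

/-! ### Additive functions on finitely generated modules -/

section AdditiveFunction

/-- The rational vector space of functions on finitely generated `R`-modules that are additive
on short exact sequences, that is, the rational dual of the Grothendieck group of `mod R`.
Such a function is given the value `0` on modules that are not finitely generated, so that two
of them agree as soon as they agree on `mod R`. -/
def additiveFunctions (R : Type u) [Ring R] : Submodule ℚ (ModuleCat.{u} R → ℚ) where
  carrier := {ψ | (∀ M : ModuleCat.{u} R, ¬ Module.Finite R M → ψ M = 0) ∧
    ∀ (M N L : ModuleCat.{u} R) (f : M →ₗ[R] N) (g : N →ₗ[R] L),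
      Module.Finite R M → Module.Finite R N → Module.Finite R L →
      Function.Injective f → Function.Exact f g → Function.Surjective g → ψ N = ψ M + ψ L}
  add_mem' {φ ψ} hφ hψ := by
    refine ⟨fun M hM => by simp [hφ.1 M hM, hψ.1 M hM], fun M N L f g h₁ h₂ h₃ hf h hg => ?_⟩
    simp only [Pi.add_apply, hφ.2 M N L f g h₁ h₂ h₃ hf h hg, hψ.2 M N L f g h₁ h₂ h₃ hf h hg]
    abel
  zero_mem' := ⟨fun _ _ => rfl, fun _ _ _ _ _ _ _ _ _ _ _ => by simp⟩
  smul_mem' c ψ hψ := by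
    refine ⟨fun M hM => by simp [hψ.1 M hM], fun M N L f g h₁ h₂ h₃ hf h hg => ?_⟩
    simp only [Pi.smul_apply, hψ.2 M N L f g h₁ h₂ h₃ hf h hg, smul_add]

/-- An additive function on finitely generated `R`-modules. -/
abbrev AdditiveFunction (R : Type u) [Ring R] : Type (u + 1) := additiveFunctions R

variable {R : Type u} [Ring R]

namespace AdditiveFunction

/-- The value of an additive function on an unbundled module. -/
abbrev eval (ψ : AdditiveFunction R) (M : Type u) [AddCommGroup M] [Module R M] : ℚ :=
  ψ.1 (ModuleCat.of R M)

variable (ψ : AdditiveFunction R) {M N L : Type u} [AddCommGroup M] [Module R M]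
  [AddCommGroup N] [Module R N] [AddCommGroup L] [Module R L]

theorem eval_add (φ : AdditiveFunction R) : (φ + ψ).eval M = φ.eval M + ψ.eval M := rfl

theorem eval_smul (c : ℚ) : (c • ψ).eval M = c • ψ.eval M := rfl

theorem eval_eq_add [Module.Finite R M] [Module.Finite R N] [Module.Finite R L]
    {f : M →ₗ[R] N} {g : N →ₗ[R] L} (hf : Function.Injective f) (h : Function.Exact f g)
    (hg : Function.Surjective g) : ψ.eval N = ψ.eval M + ψ.eval L :=
  ψ.2.2 _ _ _ f g ‹_› ‹_› ‹_› hf h hg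

theorem eval_of_subsingleton [Subsingleton M] : ψ.eval M = 0 := by
  have := ψ.eval_eq_add (f := (LinearMap.id : M →ₗ[R] M)) (g := (LinearMap.id : M →ₗ[R] M))
    Function.injective_id (fun x => ⟨fun _ => ⟨x, rfl⟩, fun _ => Subsingleton.elim _ _⟩)
    Function.surjective_id
  linarith

theorem eval_congr [Module.Finite R M] (e : M ≃ₗ[R] N) : ψ.eval M = ψ.eval N := by
  have := Module.Finite.equiv e
  have h := ψ.eval_eq_add (f := e.toLinearMap) (g := (0 : N →ₗ[R] PUnit.{u + 1})) e.injective
    (fun x => ⟨fun _ => ⟨e.symm x, e.apply_symm_apply x⟩, fun _ => rfl⟩)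
    (fun _ => ⟨0, Subsingleton.elim _ _⟩)
  rw [h, ψ.eval_of_subsingleton (M := PUnit), add_zero]

/-- An additive function vanishing on simple modules vanishes on modules of finite length. -/
theorem eval_eq_zero_of_simple (h : ∀ S : ModuleCat.{u} R, IsSimpleModule R S → ψ.1 S = 0)
    [IsNoetherianRing R] (hM : IsFiniteLength R M) : ψ.eval M = 0 := by
  induction hM with
  | of_subsingleton => exact ψ.eval_of_subsingleton
  | @of_simple_quotient M _ _ N _ hN ih =>
    have hMf : IsFiniteLength R M := .of_simple_quotient hN
    have := (isFiniteLength_iff_isNoetherian_isArtinian.1 hMf).1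
    rw [ψ.eval_eq_add (f := N.subtype) (g := N.mkQ) N.subtype_injective
      (by rw [LinearMap.exact_iff, Submodule.ker_mkQ, Submodule.range_subtype])
      N.mkQ_surjective, ih,
      show ψ.eval (M ⧸ N) = 0 from h (ModuleCat.of R (M ⧸ N)) inferInstance, add_zero]

theorem ext_of_eval (φ : AdditiveFunction R)
    (h : ∀ (M : Type u) [AddCommGroup M] [Module R M], Module.Finite R M → φ.eval M = ψ.eval M) :
    φ = ψ := by
  refine Subtype.ext (funext fun M => ?_)
  by_cases hM : Module.Finite R M
  · exact h M hM
  · rw [φ.2.1 M hM, ψ.2.1 M hM]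

end AdditiveFunction

/-- A module of finite length has only finitely many simple quotients up to isomorphism. -/
theorem exists_finset_simple_quotients {M : Type u} [AddCommGroup M] [Module R M]
    (hM : IsFiniteLength R M) :
    ∃ t : Finset (ModuleCat.{u} R), ∀ (S : ModuleCat.{u} R), IsSimpleModule R S →
      ∀ f : M →ₗ[R] S, f ≠ 0 → ∃ T ∈ t, Nonempty (S ≃ₗ[R] T) := by
  classical
  induction hM with
  | of_subsingleton => exact ⟨∅, fun S _ f hf => absurd (Subsingleton.elim _ _) hf⟩
  | @of_simple_quotient M _ _ N _ hN ih =>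
    obtain ⟨t, ht⟩ := ih
    refine ⟨insert (ModuleCat.of R (M ⧸ N)) t, fun S hS f hf => ?_⟩
    by_cases hfN : f ∘ₗ N.subtype = 0
    · have hle : N ≤ LinearMap.ker f := fun x hx => LinearMap.congr_fun hfN ⟨x, hx⟩
      have hne : N.liftQ f hle ≠ 0 := fun h0 => hf (by rw [← N.liftQ_mkQ f hle, h0]; rfl)
      exact ⟨_, Finset.mem_insert_self _ _,
        ⟨(LinearEquiv.ofBijective _ (LinearMap.bijective_of_ne_zero hne)).symm⟩⟩
    · obtain ⟨T, hT, e⟩ := ht S hS _ hfN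
      exact ⟨T, Finset.mem_insert_of_mem hT, e⟩

instance finiteDimensional_additiveFunction [IsArtinianRing R] :
    Module.Finite ℚ (AdditiveFunction R) := by
  obtain ⟨t, ht⟩ := exists_finset_simple_quotients
    (isFiniteLength_iff_isNoetherian_isArtinian.2 ⟨inferInstance, inferInstance⟩ :
      IsFiniteLength R R)
  let ev : AdditiveFunction R →ₗ[ℚ] (t → ℚ) :=
    LinearMap.pi fun T => LinearMap.proj T.1 ∘ₗ (additiveFunctions R).subtype
  refine Module.Finite.of_injective ev ((injective_iff_map_eq_zero ev).2 fun ψ hψ => ?_)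
  refine AdditiveFunction.ext_of_eval _ _ fun M _ _ hM => ?_
  refine ψ.eval_eq_zero_of_simple (fun S hS => ?_)
    (isFiniteLength_iff_isNoetherian_isArtinian.2 ⟨inferInstance, inferInstance⟩)
  have := hS.nontrivial
  obtain ⟨x, hx⟩ := exists_ne (0 : S)
  obtain ⟨T, hT, ⟨e⟩⟩ := ht S hS (LinearMap.toSpanSingleton R S x)
    fun h => hx (by simpa using LinearMap.congr_fun h 1)
  exact (ψ.eval_congr e).trans (congrFun hψ ⟨T, hT⟩)

open Classical in
/-- The length of a finitely generated module over an Artinian ring, as an additive function. -/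
noncomputable def lengthFunction (R : Type u) [Ring R] [IsArtinianRing R] :
    AdditiveFunction R where
  val M := if Module.Finite R M then ((Module.length R M).toNat : ℚ) else 0
  property := by
    refine ⟨fun M hM => if_neg hM, fun M N L f g h₁ h₂ h₃ hf h hg => ?_⟩
    beta_reduce
    rw [if_pos h₁, if_pos h₂, if_pos h₃, Module.length_eq_add_of_exact f g hf hg h,
      ENat.toNat_add Module.length_ne_top Module.length_ne_top]
    push_cast
    rfl

open Classical in
theorem subsingleton_of_lengthFunction_eq_zero [IsArtinianRing R] {M : Type u} [AddCommGroup M]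
    [Module R M] [hM : Module.Finite R M] (h : (lengthFunction R).eval M = 0) :
    Subsingleton M := by
  have h' : (Module.length R M).toNat = 0 := by
    have : (if Module.Finite R M then ((Module.length R M).toNat : ℚ) else 0) = 0 := h
    rw [if_pos hM] at this
    exact_mod_cast this
  rw [ENat.toNat_eq_zero] at h'
  exact Module.length_eq_zero_iff.1 (h'.resolve_right Module.length_ne_top)

end AdditiveFunction

/-! ### Duality with respect to a regular bimodule -/

section RegularBimodule

theorem exists_comp_eq_of_ker_le {R M N L : Type*} [Ring R] [AddCommGroup M] [Module R M]
    [AddCommGroup N] [Module R N] [AddCommGroup L] [Module R L] {g : M →ₗ[R] N}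
    (hg : Function.Surjective g) {a : M →ₗ[R] L}
    (h : LinearMap.ker g ≤ LinearMap.ker a) : ∃ b : N →ₗ[R] L, b ∘ₗ g = a := by
  refine ⟨(LinearMap.ker g).liftQ a h ∘ₗ (g.quotKerEquivOfSurjective hg).symm,
    LinearMap.ext fun x => ?_⟩
  have : (g.quotKerEquivOfSurjective hg).symm (g x) = Submodule.Quotient.mk x := by
    rw [LinearEquiv.symm_apply_eq]; rfl
  simp [this]

/-- Two commuting actions of rings `R` and `S` on `U` form a regular bimodule if `U` is free of
rank one over both rings, on one common generator. The example is `A` with the actions of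
`A` and `Aᵐᵒᵖ`; working with `R` and `S` treats left and right modules at the same time. -/
structure IsRegularBimodule (R S U : Type u) [Ring R] [Ring S] [AddCommGroup U] [Module R U]
    [Module S U] [SMulCommClass R S U] (u : U) : Prop where
  bijective_left : Function.Bijective fun r : R => r • u
  bijective_right : Function.Bijective fun s : S => s • u

/-- A module is `U`-torsionless if it embeds into a finite direct sum of copies of `U`. -/
def Torsionless (R U M : Type u) [Ring R] [AddCommGroup U] [Module R U] [AddCommGroup M]
    [Module R M] : Prop :=
  ∃ (n : ℕ) (f : M →ₗ[R] (Fin n → U)), Function.Injective f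

section Torsionless

variable {R U M N : Type u} [Ring R] [AddCommGroup U] [Module R U] [AddCommGroup M] [Module R M]
  [AddCommGroup N] [Module R N]

theorem Torsionless.of_injective (hN : Torsionless R U N) {f : M →ₗ[R] N}
    (hf : Function.Injective f) : Torsionless R U M := by
  obtain ⟨n, g, hg⟩ := hN
  exact ⟨n, g ∘ₗ f, hg.comp hf⟩

theorem torsionless_pi (n : ℕ) : Torsionless R U (Fin n → U) :=
  ⟨n, LinearMap.id, Function.injective_id⟩

theorem Torsionless.prod (hM : Torsionless R U M) (hN : Torsionless R U N) :
    Torsionless R U (M × N) := by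
  obtain ⟨m, f, hf⟩ := hM
  obtain ⟨n, g, hg⟩ := hN
  let e := (LinearEquiv.sumArrowLequivProdArrow (Fin m) (Fin n) R U).symm.trans
    (LinearEquiv.funCongrLeft R U finSumFinEquiv.symm)
  exact ⟨m + n, e.toLinearMap ∘ₗ f.prodMap g, e.injective.comp (hf.prodMap hg)⟩

end Torsionless

namespace IsRegularBimodule

variable {R S U : Type u} [Ring R] [Ring S] [AddCommGroup U] [Module R U] [Module S U]
  [SMulCommClass R S U] {u : U}
  {M N L : Type u} [AddCommGroup M] [Module R M] [AddCommGroup N] [Module R N]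
  [AddCommGroup L] [Module R L]

theorem symm [SMulCommClass S R U] (hU : IsRegularBimodule R S U u) : IsRegularBimodule S R U u :=
  ⟨hU.bijective_right, hU.bijective_left⟩

/-- The isomorphism `R ≃ U` of left modules given by the generator. -/
noncomputable def equiv (hU : IsRegularBimodule R S U u) : R ≃ₗ[R] U :=
  LinearEquiv.ofBijective (LinearMap.toSpanSingleton R U u) hU.bijective_left

theorem finite (hU : IsRegularBimodule R S U u) : Module.Finite R U :=
  Module.Finite.equiv hU.equiv

theorem projective (hU : IsRegularBimodule R S U u) : Module.Projective R U :=
  Module.Projective.of_equiv hU.equiv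

theorem projective_pi (hU : IsRegularBimodule R S U u) (n : ℕ) :
    Module.Projective R (Fin n → U) :=
  Module.Projective.of_equiv (LinearEquiv.piCongrRight fun _ : Fin n => hU.equiv)

theorem torsionless_free (hU : IsRegularBimodule R S U u) (n : ℕ) :
    Torsionless R U (Fin n → R) :=
  ⟨n, (LinearEquiv.piCongrRight fun _ => hU.equiv).toLinearMap, LinearEquiv.injective _⟩

theorem extVanish_free (hU : IsRegularBimodule R S U u) (n : ℕ) (Z : Type u) [AddCommGroup Z]
    [Module R Z] : ExtVanish R (Fin n → U) Z 1 :=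
  haveI := hU.projective_pi n
  extVanish_of_projective 0

/-- If `U` has injective dimension at most one, torsionless modules are `Ext`-orthogonal
to `U`. -/
theorem extVanish_of_torsionless (hU : IsRegularBimodule R S U u)
    (hid : HasInjectiveDimensionLT (ModuleCat.of R U) 2) (hM : Torsionless R U M) :
    ExtVanish R M U 1 := by
  obtain ⟨n, f, hf⟩ := hM
  refine extVanish_left (g := (LinearMap.range f).mkQ) hf
    (by rw [LinearMap.exact_iff, Submodule.ker_mkQ]) (Submodule.mkQ_surjective _) 1
    (hU.extVanish_free n U) ?_
  exact HasInjectiveDimensionLT.subsingleton (ModuleCat.of R U) 2 2 le_rfl _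

variable [SMulCommClass S R U]

theorem finite_hom (hU : IsRegularBimodule R S U u) [IsNoetherianRing S] [Module.Finite R M] :
    Module.Finite S (M →ₗ[R] U) := by
  have := hU.symm.finite
  obtain ⟨n, x, hx⟩ := Module.Finite.exists_fin (R := R) (M := M)
  let ev : (M →ₗ[R] U) →ₗ[S] (Fin n → U) :=
    { toFun := fun f i => f (x i), map_add' := fun _ _ => rfl, map_smul' := fun _ _ => rfl }
  refine Module.Finite.of_injective ev fun f g h => LinearMap.ext_on_range hx fun i => ?_
  exact congrFun h i

/-- A finitely generated module has a left approximation by sums of copies of `U`. -/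
theorem exists_approximation (hU : IsRegularBimodule R S U u) [IsNoetherianRing S]
    [Module.Finite R M] :
    ∃ (n : ℕ) (a : M →ₗ[R] (Fin n → U)), ∀ h : M →ₗ[R] U,
      ∃ b : (Fin n → U) →ₗ[R] U, b ∘ₗ a = h := by
  have := hU.finite_hom (M := M)
  obtain ⟨n, x, hx⟩ := Module.Finite.exists_fin (R := S) (M := M →ₗ[R] U)
  refine ⟨n, LinearMap.pi x, fun h => ?_⟩
  obtain ⟨c, hc⟩ := (Submodule.mem_span_range_iff_exists_fun S).1
    (hx.symm ▸ Submodule.mem_top : h ∈ Submodule.span S (Set.range x))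
  refine ⟨∑ i, c i • LinearMap.proj i, ?_⟩
  rw [← hc]
  ext m
  simp [LinearMap.sum_apply]

/-- A left approximation of a torsionless module is injective. -/
theorem injective_of_approximation (hM : Torsionless R U M) {n : ℕ} {a : M →ₗ[R] (Fin n → U)}
    (ha : ∀ h : M →ₗ[R] U, ∃ b : (Fin n → U) →ₗ[R] U, b ∘ₗ a = h) : Function.Injective a := by
  obtain ⟨k, f, hf⟩ := hM
  refine (injective_iff_map_eq_zero a).2 fun x hx => hf (funext fun i => ?_)
  obtain ⟨b, hb⟩ := ha (LinearMap.proj i ∘ₗ f)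
  have := LinearMap.congr_fun hb x
  simpa [hx] using this.symm

/-- Additive functions see the sequence `0 → L* → N* → M* → 0` as soon as linear maps `M → U`
extend to `N`. -/
theorem eval_hom_eq_add (hU : IsRegularBimodule R S U u) [IsNoetherianRing S]
    (ψ : AdditiveFunction S) [Module.Finite R M] [Module.Finite R N] [Module.Finite R L]
    {f : M →ₗ[R] N} {g : N →ₗ[R] L} (h : Function.Exact f g) (hg : Function.Surjective g)
    (hex : ∀ a : M →ₗ[R] U, ∃ b : N →ₗ[R] U, b ∘ₗ f = a) :
    ψ.eval (N →ₗ[R] U) = ψ.eval (L →ₗ[R] U) + ψ.eval (M →ₗ[R] U) := by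
  have := hU.finite_hom (M := M)
  have := hU.finite_hom (M := N)
  have := hU.finite_hom (M := L)
  refine ψ.eval_eq_add (f := LinearMap.lcomp S U g) (g := LinearMap.lcomp S U f) ?_ ?_ ?_
  · intro a b hab
    refine LinearMap.ext fun x => ?_
    obtain ⟨y, rfl⟩ := hg x
    exact LinearMap.congr_fun hab y
  · intro a
    constructor
    · intro ha
      refine exists_comp_eq_of_ker_le hg fun x hx => ?_
      obtain ⟨y, rfl⟩ := (h x).1 hx
      exact LinearMap.congr_fun ha y
    · rintro ⟨b, rfl⟩
      ext x
      simp [h.apply_apply_eq_zero]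
  · exact hex

section Euler

variable [IsNoetherianRing S]

theorem eval_hom_eq_add_of_torsionless (hU : IsRegularBimodule R S U u)
    (hid : HasInjectiveDimensionLT (ModuleCat.of R U) 2) (ψ : AdditiveFunction S)
    [Module.Finite R M] [Module.Finite R N] [Module.Finite R L]
    {f : M →ₗ[R] N} {g : N →ₗ[R] L} (hf : Function.Injective f) (h : Function.Exact f g)
    (hg : Function.Surjective g) (hL : Torsionless R U L) :
    ψ.eval (N →ₗ[R] U) = ψ.eval (L →ₗ[R] U) + ψ.eval (M →ₗ[R] U) :=
  hU.eval_hom_eq_add ψ h hg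
    (exists_extend_of_extVanish hf h hg (hU.extVanish_of_torsionless hid hL))

variable [IsNoetherianRing R]

variable {Q Q' Z : Type u} [AddCommGroup Q] [Module R Q] [AddCommGroup Q'] [Module R Q']
  [AddCommGroup Z] [Module R Z]

/-- One half of the comparison of two torsionless resolutions through their fibre product. -/
theorem eval_fiberProduct (hU : IsRegularBimodule R S U u)
    (hid : HasInjectiveDimensionLT (ModuleCat.of R U) 2) (ψ : AdditiveFunction S)
    [Module.Finite R Q] [Module.Finite R Q'] (hQ : Torsionless R U Q)
    {q : Q →ₗ[R] Z} {q' : Q' →ₗ[R] Z} (hq' : Function.Surjective q') :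
    ψ.eval (LinearMap.eqLocus (q ∘ₗ LinearMap.fst R Q Q') (q' ∘ₗ LinearMap.snd R Q Q') →ₗ[R] U) =
      ψ.eval (Q →ₗ[R] U) + ψ.eval (LinearMap.ker q' →ₗ[R] U) := by
  refine hU.eval_hom_eq_add_of_torsionless hid ψ
    (f := (LinearMap.inr R Q Q' ∘ₗ (LinearMap.ker q').subtype).codRestrict _ fun x => ?_)
    (g := LinearMap.fst R Q Q' ∘ₗ Submodule.subtype _) ?_ ?_ ?_ hQ
  · simp
  · intro x y hxy
    exact Subtype.ext (congrArg (fun z => z.1.2) hxy)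
  · rintro ⟨⟨x, y⟩, hxy⟩
    constructor
    · intro h
      obtain rfl : x = 0 := h
      have hy : y ∈ LinearMap.ker q' := by simpa using hxy.symm
      exact ⟨⟨y, hy⟩, rfl⟩
    · rintro ⟨z, hz⟩
      exact (congrArg (fun w => w.1.1) hz).symm
  · intro x
    obtain ⟨y, hy⟩ := hq' (q x)
    exact ⟨⟨(x, y), hy.symm⟩, rfl⟩

/-- The difference `ψ(Q*) - ψ(K*)` does not depend on the torsionless resolution
`0 → K → Q → Z → 0`: both resolutions are compared with their fibre product. -/
theorem eval_sub_eval_ker_eq (hU : IsRegularBimodule R S U u)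
    (hid : HasInjectiveDimensionLT (ModuleCat.of R U) 2) (ψ : AdditiveFunction S)
    [Module.Finite R Q] [Module.Finite R Q'] (hQ : Torsionless R U Q) (hQ' : Torsionless R U Q')
    {q : Q →ₗ[R] Z} {q' : Q' →ₗ[R] Z} (hq : Function.Surjective q)
    (hq' : Function.Surjective q') :
    ψ.eval (Q →ₗ[R] U) - ψ.eval (LinearMap.ker q →ₗ[R] U) =
      ψ.eval (Q' →ₗ[R] U) - ψ.eval (LinearMap.ker q' →ₗ[R] U) := by
  have h₁ := hU.eval_fiberProduct hid ψ hQ (q := q) hq'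
  have h₂ := hU.eval_hom_eq_add_of_torsionless hid ψ
    (M := LinearMap.ker q) (L := Q')
    (N := LinearMap.eqLocus (q ∘ₗ LinearMap.fst R Q Q') (q' ∘ₗ LinearMap.snd R Q Q'))
    (f := (LinearMap.inl R Q Q' ∘ₗ (LinearMap.ker q).subtype).codRestrict _ fun x => by simp)
    (g := LinearMap.snd R Q Q' ∘ₗ Submodule.subtype _) ?_ ?_ ?_ hQ'
  · linarith
  · intro x y hxy
    exact Subtype.ext (congrArg (fun z => z.1.1) hxy)
  · rintro ⟨⟨x, y⟩, hxy⟩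
    constructor
    · intro h
      obtain rfl : y = 0 := h
      have hx : x ∈ LinearMap.ker q := by simpa using hxy
      exact ⟨⟨x, hx⟩, rfl⟩
    · rintro ⟨z, hz⟩
      exact (congrArg (fun w => w.1.2) hz).symm
  · intro y
    obtain ⟨x, hx⟩ := hq (q' y)
    exact ⟨⟨(x, y), hx⟩, rfl⟩

end Euler

end IsRegularBimodule

end RegularBimodule

/-! ### The Euler form of a regular bimodule of injective dimension one -/

section EulerForm

namespace IsRegularBimodule

variable {R S U : Type u} [Ring R] [Ring S] [AddCommGroup U] [Module R U] [Module S U]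
  [SMulCommClass R S U] [SMulCommClass S R U] {u : U}
  {M N L : Type u} [AddCommGroup M] [Module R M] [AddCommGroup N] [Module R N]
  [AddCommGroup L] [Module R L]

section Bidual

variable {P P₀ P₁ : Type u} [AddCommGroup P] [Module S P] [AddCommGroup P₀] [Module S P₀]
  [AddCommGroup P₁] [Module S P₁]

variable (R S U P) in
/-- The evaluation map of an `S`-module into its bidual with respect to `U`. -/
def bidual : P →ₗ[S] ((P →ₗ[S] U) →ₗ[R] U) where
  toFun x := { toFun := fun g => g x, map_add' := fun _ _ => rfl, map_smul' := fun _ _ => rfl }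
  map_add' x y := LinearMap.ext fun g => map_add g x y
  map_smul' s x := LinearMap.ext fun g => map_smul g s x

@[simp]
theorem bidual_apply (x : P) (g : P →ₗ[S] U) : bidual R S U P x g = g x := rfl

theorem bijective_bidual (hU : IsRegularBimodule R S U u) [Module.Finite S P]
    [Module.Projective S P] : Function.Bijective (bidual R S U P) := by
  obtain ⟨n, r, hr⟩ := Module.Finite.exists_fin' S P
  obtain ⟨i, hi⟩ := r.exists_rightInverse_of_surjective (LinearMap.range_eq_top.2 hr)
  have hri : ∀ x, r (i x) = x := LinearMap.congr_fun hi
  let c : Fin n → (P →ₗ[S] U) := fun k =>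
    hU.symm.equiv.toLinearMap ∘ₗ LinearMap.proj k ∘ₗ i
  have hc : ∀ k x, c k x = (i x k) • u := fun k x => rfl
  have hsum : ∀ (g : P →ₗ[S] U) (v : Fin n → S),
      g (r v) = ∑ k, v k • g (r fun j => if k = j then 1 else 0) := fun g v =>
    LinearMap.pi_apply_eq_sum_univ (g ∘ₗ r) v
  constructor
  · refine (injective_iff_map_eq_zero _).2 fun x hx => ?_
    have : i x = 0 := funext fun k => hU.symm.equiv.injective
      ((LinearMap.congr_fun hx (c k)).trans (map_zero hU.symm.equiv).symm)
    rw [← hri x, this, map_zero]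
  · intro φ
    choose s hs using fun k => hU.bijective_right.2 (φ (c k))
    refine ⟨r s, LinearMap.ext fun g => ?_⟩
    choose ρ hρ using fun k => hU.bijective_left.2 (g (r fun j => if k = j then 1 else 0))
    beta_reduce at hs hρ
    -- the functionals `c k` form a dual basis
    have hg : g = ∑ k, ρ k • c k := by
      ext y
      rw [← hri y, hsum g, LinearMap.sum_apply]
      refine Finset.sum_congr rfl fun k _ => ?_
      rw [LinearMap.smul_apply, hc, hri, ← hρ, smul_comm]
    rw [bidual_apply, hsum g]
    conv_rhs => rw [hg, map_sum]
    refine Finset.sum_congr rfl fun k _ => ?_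
    rw [map_smul, ← hs, ← hρ, smul_comm]

/-- For a presentation `d : P₁ → P₀`, the dual of the transpose `Coker (P₀* → P₁*)` is the
kernel of `d`. -/
noncomputable def kerEquivHomCoker (hU : IsRegularBimodule R S U u) [Module.Finite S P₀]
    [Module.Projective S P₀] [Module.Finite S P₁] [Module.Projective S P₁] (d : P₁ →ₗ[S] P₀) :
    LinearMap.ker d ≃ₗ[S]
      (((P₁ →ₗ[S] U) ⧸ LinearMap.range (LinearMap.lcomp R U d)) →ₗ[R] U) :=
  LinearEquiv.ofBijective
    { toFun := fun x : LinearMap.ker d => (LinearMap.range (LinearMap.lcomp R U d)).liftQ (bidual R S U P₁ x.1) (by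
        rintro _ ⟨g, rfl⟩
        have hx : d x = 0 := x.2
        simp [hx])
      map_add' := fun x y => by
        refine Submodule.linearMap_qext _ (LinearMap.ext fun g => ?_)
        simp
      map_smul' := fun s x => by
        refine Submodule.linearMap_qext _ (LinearMap.ext fun g => ?_)
        simp }
    (by
      constructor
      · intro x y hxy
        refine Subtype.ext (hU.bijective_bidual.1 (LinearMap.ext fun g => ?_))
        exact LinearMap.congr_fun hxy (Submodule.Quotient.mk g)
      · intro φ
        obtain ⟨x, hx⟩ := hU.bijective_bidual.2
          (φ ∘ₗ (LinearMap.range (LinearMap.lcomp R U d)).mkQ)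
        have hdx : d x = 0 := by
          refine hU.bijective_bidual.1 (LinearMap.ext fun g => ?_)
          have h := LinearMap.congr_fun hx (LinearMap.lcomp R U d g)
          have h0 : (LinearMap.range (LinearMap.lcomp R U d)).mkQ (LinearMap.lcomp R U d g) = 0 :=
            (Submodule.Quotient.mk_eq_zero _).2 ⟨g, rfl⟩
          rw [LinearMap.comp_apply, h0, map_zero] at h
          simpa using h
        refine ⟨⟨x, hdx⟩, Submodule.linearMap_qext _ (LinearMap.ext fun g => ?_)⟩
        exact LinearMap.congr_fun hx g)

end Bidual

variable [IsNoetherianRing S]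

theorem eval_hom_congr (hU : IsRegularBimodule R S U u) (ψ : AdditiveFunction S)
    [Module.Finite R M] [Module.Finite R N] (e : M ≃ₗ[R] N) :
    ψ.eval (M →ₗ[R] U) = ψ.eval (N →ₗ[R] U) := by
  have h := hU.eval_hom_eq_add ψ (f := e.toLinearMap) (g := (0 : N →ₗ[R] PUnit.{u + 1}))
    (fun x => ⟨fun _ => ⟨e.symm x, e.apply_symm_apply x⟩, fun _ => rfl⟩)
    (fun _ => ⟨0, Subsingleton.elim _ _⟩)
    (fun a => ⟨a ∘ₗ e.symm.toLinearMap, by ext x; simp⟩)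
  rw [h, ψ.eval_of_subsingleton (M := PUnit.{u + 1} →ₗ[R] U), zero_add]

open Classical in
variable (R S U) in
/-- The value on `Z` of the function dual to `Z ↦ [Hom(Z, U)] - [Ext¹(Z, U)]`, computed from a
free resolution `0 → K → Q → Z → 0` as `ψ(Q*) - ψ(K*)`. -/
noncomputable def eulerValue (ψ : AdditiveFunction S) (Z : ModuleCat.{u} R) : ℚ :=
  if _h : Module.Finite R Z then
    ψ.eval ((Fin (Module.Finite.exists_fin' R Z).choose → R) →ₗ[R] U) -
      ψ.eval (LinearMap.ker (Module.Finite.exists_fin' R Z).choose_spec.choose →ₗ[R] U)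
  else 0

variable {Q K Z : Type u} [AddCommGroup Q] [Module R Q] [AddCommGroup K]
  [Module R K] [AddCommGroup Z] [Module R Z]

variable [IsNoetherianRing R]

/-- The Euler value may be computed from an arbitrary torsionless resolution. -/
theorem eulerValue_eq (hU : IsRegularBimodule R S U u)
    (hid : HasInjectiveDimensionLT (ModuleCat.of R U) 2) (ψ : AdditiveFunction S)
    [Module.Finite R Q] (hQ : Torsionless R U Q) {k : K →ₗ[R] Q} {q : Q →ₗ[R] Z}
    (hk : Function.Injective k) (h : Function.Exact k q) (hq : Function.Surjective q) :
    eulerValue R S U ψ (ModuleCat.of R Z) = ψ.eval (Q →ₗ[R] U) - ψ.eval (K →ₗ[R] U) := by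
  have hZ : Module.Finite R Z := Module.Finite.of_surjective q hq
  have hK : Module.Finite R K := Module.Finite.of_injective k hk
  have hr : LinearMap.range k = LinearMap.ker q := (LinearMap.exact_iff.1 h).symm
  rw [hU.eval_hom_congr ψ ((LinearEquiv.ofInjective k hk).trans (LinearEquiv.ofEq _ _ hr)),
    eulerValue, dif_pos hZ]
  exact hU.eval_sub_eval_ker_eq hid ψ (hU.torsionless_free _) hQ
    (Module.Finite.exists_fin' R Z).choose_spec.choose_spec hq

theorem eulerValue_eq_add (hU : IsRegularBimodule R S U u)
    (hid : HasInjectiveDimensionLT (ModuleCat.of R U) 2) (ψ : AdditiveFunction S)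
    [Module.Finite R N] {f : M →ₗ[R] N} {g : N →ₗ[R] L} (hf : Function.Injective f)
    (h : Function.Exact f g) (hg : Function.Surjective g) :
    eulerValue R S U ψ (ModuleCat.of R N) =
      eulerValue R S U ψ (ModuleCat.of R M) + eulerValue R S U ψ (ModuleCat.of R L) := by
  obtain ⟨n, q, hq⟩ := Module.Finite.exists_fin' R N
  have hQ := hU.torsionless_free n
  let K₂ := LinearMap.ker q
  let K₃ := LinearMap.ker (g ∘ₗ q)
  have hle : K₂ ≤ K₃ := fun x hx => by
    have hx' : q x = 0 := hx
    simp [K₃, hx']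
  -- `K₃ → M` with kernel `K₂` is a torsionless resolution of `M`
  have hmem : ∀ x : K₃, q x ∈ LinearMap.range f := fun x => (h _).1 x.2
  let q₁ : K₃ →ₗ[R] M := (LinearEquiv.ofInjective f hf).symm.toLinearMap ∘ₗ
    (q ∘ₗ K₃.subtype).codRestrict _ hmem
  have hq₁ : ∀ x, f (q₁ x) = q x := fun x =>
    congrArg Subtype.val ((LinearEquiv.ofInjective f hf).apply_symm_apply ⟨q x, hmem x⟩)
  have e₁ := hU.eulerValue_eq hid ψ (hQ.of_injective K₃.subtype_injective)
    (k := Submodule.inclusion hle) (q := q₁) (Submodule.inclusion_injective hle)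
    (fun x => ⟨fun hx => ⟨⟨x, by
      show q x = 0
      rw [← hq₁, hx, map_zero]⟩, rfl⟩, by
      rintro ⟨y, rfl⟩
      exact hf (by rw [hq₁, map_zero]; exact y.2)⟩)
    (fun m => by
      obtain ⟨x, hx⟩ := hq (f m)
      exact ⟨⟨x, by simp [K₃, hx, h.apply_apply_eq_zero]⟩, hf ((hq₁ _).trans hx)⟩)
  have e₂ := hU.eulerValue_eq hid ψ hQ (k := K₂.subtype) (q := q) K₂.subtype_injective
    (by rw [LinearMap.exact_iff, Submodule.range_subtype]) hq
  have e₃ := hU.eulerValue_eq hid ψ hQ (k := K₃.subtype) (q := g ∘ₗ q) K₃.subtype_injective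
    (by rw [LinearMap.exact_iff, Submodule.range_subtype]) (hg.comp hq)
  rw [e₁, e₂, e₃]
  ring

/-- The linear map on additive functions dual to `Z ↦ [Hom(Z, U)] - [Ext¹(Z, U)]`. -/
noncomputable def eulerMap (hU : IsRegularBimodule R S U u)
    (hid : HasInjectiveDimensionLT (ModuleCat.of R U) 2) :
    AdditiveFunction S →ₗ[ℚ] AdditiveFunction R where
  toFun ψ := ⟨eulerValue R S U ψ, fun _ hM => dif_neg hM,
    fun _ _ _ _ _ _ _ _ hf h hg => hU.eulerValue_eq_add hid ψ hf h hg⟩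
  map_add' φ ψ := by
    refine Subtype.ext (funext fun Z => ?_)
    by_cases hZ : Module.Finite R Z
    · simp only [eulerValue, dif_pos hZ, AdditiveFunction.eval_add, Submodule.coe_add,
        Pi.add_apply]
      ring
    · simp [eulerValue, dif_neg hZ]
  map_smul' c ψ := by
    refine Subtype.ext (funext fun Z => ?_)
    by_cases hZ : Module.Finite R Z
    · simp only [eulerValue, dif_pos hZ, AdditiveFunction.eval_smul, Submodule.coe_smul, Pi.smul_apply, smul_sub,
        RingHom.id_apply]
    · simp [eulerValue, dif_neg hZ]

/-- Every second syzygy `Ker (P₁ → P₀)` is a dual, and the dual of `Z` is the dual of the largest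
torsionless quotient of `Z`; so an additive function in the kernel of the Euler map, which
vanishes on duals of torsionless modules, vanishes on second syzygies and on free modules. -/
theorem injective_eulerMap (hU : IsRegularBimodule R S U u)
    (hid : HasInjectiveDimensionLT (ModuleCat.of R U) 2) :
    Function.Injective (hU.eulerMap hid) := by
  refine (injective_iff_map_eq_zero _).2 fun ψ hψ => ?_
  have htl : ∀ (Q : Type u) [AddCommGroup Q] [Module R Q] [Module.Finite R Q],
      Torsionless R U Q → ψ.eval (Q →ₗ[R] U) = 0 := by
    intro Q _ _ _ hQ
    have h := hU.eulerValue_eq hid ψ hQ (k := (0 : PUnit.{u + 1} →ₗ[R] Q)) (q := LinearMap.id)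
      (fun _ _ _ => Subsingleton.elim _ _)
      (fun x => ⟨fun hx => ⟨0, hx.symm⟩, by rintro ⟨_, rfl⟩; rfl⟩) Function.surjective_id
    have h0 : eulerValue R S U ψ (ModuleCat.of R Q) = 0 :=
      congrFun (congrArg Subtype.val hψ) (ModuleCat.of R Q)
    rw [h0, ψ.eval_of_subsingleton (M := PUnit.{u + 1} →ₗ[R] U)] at h
    linarith
  have hdual : ∀ (Z : Type u) [AddCommGroup Z] [Module R Z] [Module.Finite R Z],
      ψ.eval (Z →ₗ[R] U) = 0 := by
    intro Z _ _ _
    obtain ⟨n, a, ha⟩ := hU.exists_approximation (M := Z)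
    have hW : Torsionless R U (LinearMap.range a) :=
      (torsionless_pi n).of_injective (LinearMap.range a).subtype_injective
    have := hU.finite_hom (M := LinearMap.range a)
    rw [← htl _ hW]
    refine (ψ.eval_congr (LinearEquiv.ofBijective (LinearMap.lcomp S U a.rangeRestrict)
      ⟨fun b c hbc => LinearMap.ext fun y => ?_, fun b => ?_⟩)).symm
    · obtain ⟨x, rfl⟩ := a.surjective_rangeRestrict y
      exact LinearMap.congr_fun hbc x
    · obtain ⟨c, rfl⟩ := ha b
      exact ⟨c ∘ₗ (LinearMap.range a).subtype, rfl⟩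
  have hfree : ∀ n : ℕ, ψ.eval (Fin n → S) = 0 := by
    intro n
    have := hU.symm.finite_hom (M := Fin n → S)
    rw [ψ.eval_congr (LinearEquiv.ofBijective _ (hU.bijective_bidual (P := Fin n → S)))]
    exact hdual _
  refine AdditiveFunction.ext_of_eval _ _ fun X _ _ _ => ?_
  obtain ⟨n, p, hp⟩ := Module.Finite.exists_fin' S X
  obtain ⟨m, p', hp'⟩ := Module.Finite.exists_fin' S (LinearMap.ker p)
  let d := (LinearMap.ker p).subtype ∘ₗ p'
  have := hU.symm.finite_hom (M := Fin m → S)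
  have h₀ : ψ.eval (LinearMap.ker d) = 0 := by
    rw [ψ.eval_congr (hU.kerEquivHomCoker d)]
    exact hdual _
  have h₁ : ψ.eval (Fin n → S) = ψ.eval (LinearMap.ker p) + ψ.eval X :=
    ψ.eval_eq_add (LinearMap.ker p).subtype_injective
      (by rw [LinearMap.exact_iff, Submodule.range_subtype]) hp
  have h₂ : ψ.eval (Fin m → S) = ψ.eval (LinearMap.ker d) + ψ.eval (LinearMap.ker p) :=
    ψ.eval_eq_add (f := (LinearMap.ker d).subtype) (g := p') (LinearMap.ker d).subtype_injective
      (by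
        rw [LinearMap.exact_iff, Submodule.range_subtype]
        exact (LinearMap.ker_comp_of_ker_eq_bot p' (Submodule.ker_subtype _)).symm) hp'
  rw [hfree, h₀] at h₂
  rw [hfree] at h₁
  show ψ.eval X = 0
  linarith

end IsRegularBimodule

end EulerForm

/-! ### Injective modules have projective dimension at most one -/

section ProjectiveDimension

namespace IsRegularBimodule

variable {R S U : Type u} [Ring R] [Ring S] [AddCommGroup U] [Module R U] [Module S U]
  [SMulCommClass R S U] [SMulCommClass S R U] {u : U} [IsArtinianRing R] [IsArtinianRing S]
  {Y : Type u} [AddCommGroup Y] [Module R Y] [Module.Finite R Y]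

/-- If `mod R` and `mod S` have Grothendieck groups of the same rank, the Euler map is bijective,
so the length of `Y` is determined by `[Hom(Y, U)] - [Ext¹(Y, U)]`. -/
theorem subsingleton_of_hom_ext_eq_zero (hU : IsRegularBimodule R S U u)
    (hid : HasInjectiveDimensionLT (ModuleCat.of R U) 2)
    (hrank : Module.finrank ℚ (AdditiveFunction R) ≤ Module.finrank ℚ (AdditiveFunction S))
    (hY : ExtVanish R Y U 1) (hY0 : ∀ f : Y →ₗ[R] U, f = 0) : Subsingleton Y := by
  have hinj := hU.injective_eulerMap hid
  obtain ⟨ψ, hψ⟩ := (LinearMap.injective_iff_surjective_of_finrank_eq_finrank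
    (le_antisymm (LinearMap.finrank_le_finrank_of_injective hinj) hrank)).1 hinj
    (lengthFunction R)
  obtain ⟨n, q, hq⟩ := Module.Finite.exists_fin' R Y
  have hexact : Function.Exact (LinearMap.ker q).subtype q := by
    rw [LinearMap.exact_iff, Submodule.range_subtype]
  have h₁ := hU.eulerValue_eq hid ψ (hU.torsionless_free n)
    (LinearMap.ker q).subtype_injective hexact hq
  have h₂ := hU.eval_hom_eq_add ψ hexact hq
    (exists_extend_of_extVanish (LinearMap.ker q).subtype_injective hexact hq hY)
  have : Subsingleton (Y →ₗ[R] U) := subsingleton_of_forall_eq 0 hY0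
  have h₃ : ψ.eval (Y →ₗ[R] U) = 0 := ψ.eval_of_subsingleton
  refine subsingleton_of_lengthFunction_eq_zero (R := R) ?_
  rw [← hψ]
  show eulerValue R S U ψ (ModuleCat.of R Y) = 0
  linarith

/-- If `Ext¹(Y, U) = 0`, then the torsion part of `Y`, the kernel of a left approximation, has
vanishing `Hom` and `Ext¹` into `U`, so it is zero. -/
theorem torsionless_of_extVanish (hU : IsRegularBimodule R S U u)
    (hid : HasInjectiveDimensionLT (ModuleCat.of R U) 2)
    (hrank : Module.finrank ℚ (AdditiveFunction R) ≤ Module.finrank ℚ (AdditiveFunction S))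
    (hY : ExtVanish R Y U 1) : Torsionless R U Y := by
  obtain ⟨n, a, ha⟩ := hU.exists_approximation (M := Y)
  have hexact : Function.Exact (LinearMap.ker a).subtype a.rangeRestrict := by
    rw [LinearMap.exact_iff, Submodule.range_subtype, LinearMap.ker_rangeRestrict]
  have hW : ExtVanish R (LinearMap.range a) U 1 := hU.extVanish_of_torsionless hid
    ((torsionless_pi n).of_injective (LinearMap.range a).subtype_injective)
  have hV : Subsingleton (LinearMap.ker a) := by
    refine hU.subsingleton_of_hom_ext_eq_zero hid hrank ?_ fun f => ?_
    · exact extVanish_left (LinearMap.ker a).subtype_injective hexact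
        a.surjective_rangeRestrict 1 hY
        (HasInjectiveDimensionLT.subsingleton (ModuleCat.of R U) 2 2 le_rfl _)
    · obtain ⟨g, rfl⟩ := exists_extend_of_extVanish (LinearMap.ker a).subtype_injective hexact
        a.surjective_rangeRestrict hW f
      obtain ⟨b, rfl⟩ := ha g
      ext x
      have hx : a x = 0 := x.2
      simp [hx]
  exact ⟨n, a, LinearMap.ker_eq_bot.1 (Submodule.subsingleton_iff_eq_bot.1 hV)⟩

/-- A module in the left orthogonal of `U` embeds into some `Uⁿ` with cokernel in the left
orthogonal. -/
theorem exists_embedding_of_extVanish (hU : IsRegularBimodule R S U u)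
    (hid : HasInjectiveDimensionLT (ModuleCat.of R U) 2)
    (hrank : Module.finrank ℚ (AdditiveFunction R) ≤ Module.finrank ℚ (AdditiveFunction S))
    (hY : ExtVanish R Y U 1) :
    ∃ (n : ℕ) (a : Y →ₗ[R] (Fin n → U)), Function.Injective a ∧
      ExtVanish R ((Fin n → U) ⧸ LinearMap.range a) U 1 := by
  obtain ⟨n, a, ha⟩ := hU.exists_approximation (M := Y)
  have hinj := injective_of_approximation (hU.torsionless_of_extVanish hid hrank hY) ha
  exact ⟨n, a, hinj, extVanish_one_of_exists_extend hinj (LinearMap.exact_map_mkQ_range a)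
    (Submodule.mkQ_surjective _) (hU.extVanish_free n U) ha⟩

/-- Let `K` be a syzygy of the injective module `Y` and `g : K → Uᵐ` a left approximation. The
pushout `E` of `g` and `K → Q` is an extension of `Y` by `Uᵐ` lying in the left orthogonal of `U`.
It embeds into some `Uʳ` with cokernel `C` in this orthogonal; as `Ext¹(C, E)` vanishes, `E` is a
summand of `Uʳ`, hence projective. -/
theorem hasProjectiveDimensionLT_two_of_injective (hU : IsRegularBimodule R S U u)
    (hid : HasInjectiveDimensionLT (ModuleCat.of R U) 2)
    (hrank : Module.finrank ℚ (AdditiveFunction R) ≤ Module.finrank ℚ (AdditiveFunction S))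
    [Module.Injective R Y] : HasProjectiveDimensionLT (ModuleCat.of R Y) 2 := by
  have := hU.finite
  have := hU.projective_pi
  obtain ⟨n, q, hq⟩ := Module.Finite.exists_fin' R Y
  let K := LinearMap.ker q
  obtain ⟨m, g, hg⟩ := hU.exists_approximation (M := K)
  let j : K →ₗ[R] (Fin m → U) × (Fin n → R) := g.prod K.subtype
  have hj : Function.Injective j := fun x y hxy => Subtype.ext (congrArg Prod.snd hxy)
  let E := ((Fin m → U) × (Fin n → R)) ⧸ LinearMap.range j
  let π : ((Fin m → U) × (Fin n → R)) →ₗ[R] E := (LinearMap.range j).mkQ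
  have hπ : Function.Surjective π := Submodule.mkQ_surjective _
  have hjπ : Function.Exact j π := LinearMap.exact_map_mkQ_range j
  have hprod : Module.Projective R ((Fin m → U) × (Fin n → R)) := inferInstance
  have hEU : ExtVanish R E U 1 := by
    refine extVanish_one_of_exists_extend hj hjπ hπ (extVanish_of_projective 0) fun a => ?_
    obtain ⟨b, rfl⟩ := hg a
    exact ⟨b ∘ₗ LinearMap.fst R _ _, rfl⟩
  -- the sequence `0 → Uᵐ → E → Y → 0`
  have hker : LinearMap.range j ≤ LinearMap.ker (q ∘ₗ LinearMap.snd R (Fin m → U) _) := by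
    rintro _ ⟨x, rfl⟩
    exact x.2
  let p : E →ₗ[R] Y := (LinearMap.range j).liftQ (q ∘ₗ LinearMap.snd R _ _) hker
  have hp : Function.Surjective p := fun y => by
    obtain ⟨x, rfl⟩ := hq y
    exact ⟨π (0, x), rfl⟩
  let i : (Fin m → U) →ₗ[R] E := π ∘ₗ LinearMap.inl R _ _
  have hi : Function.Injective i := by
    refine (injective_iff_map_eq_zero i).2 fun v hv => ?_
    obtain ⟨k, hk⟩ := (hjπ _).1 hv
    have hk0 : k = 0 := Subtype.ext (congrArg Prod.snd hk)
    rw [hk0, map_zero] at hk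
    exact (congrArg Prod.fst hk).symm
  have hip : Function.Exact i p := by
    intro e
    obtain ⟨⟨v, x⟩, rfl⟩ := hπ e
    constructor
    · intro hx
      refine ⟨v - g ⟨x, hx⟩, ?_⟩
      rw [← sub_eq_zero, LinearMap.comp_apply, ← map_sub]
      refine (hjπ _).2 ⟨-⟨x, hx⟩, Prod.ext ?_ ?_⟩
      · simp [j]
      · simp [j]
    · rintro ⟨w, hw⟩
      rw [← hw]
      show q 0 = 0
      exact map_zero q
  obtain ⟨r, a, ha, hC⟩ := hU.exists_embedding_of_extVanish hid hrank hEU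
  have hCE : ExtVanish R ((Fin r → U) ⧸ LinearMap.range a) E 1 :=
    extVanish_middle' hi hip hp 1 (extVanish_pi' 1 hC m) (extVanish_of_injective 0)
  obtain ⟨b, hb⟩ := exists_extend_of_extVanish ha (LinearMap.exact_map_mkQ_range a)
    (Submodule.mkQ_surjective _) hCE LinearMap.id
  have hE : Module.Projective R E := Module.Projective.of_split a b hb
  have hK : HasProjectiveDimensionLT (ModuleCat.of R K) 1 :=
    (shortExact_shortComplexOf hj hjπ hπ).hasProjectiveDimensionLT_X₁ 1
      (inferInstanceAs (HasProjectiveDimensionLT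
        (ModuleCat.of R ((Fin m → U) × (Fin n → R))) 1))
      (inferInstanceAs (HasProjectiveDimensionLT (ModuleCat.of R E) 2))
  have hKq : Function.Exact K.subtype q := by rw [LinearMap.exact_iff, Submodule.range_subtype]
  exact (shortExact_shortComplexOf K.subtype_injective hKq hq).hasProjectiveDimensionLT_X₃ 1 hK
      (inferInstanceAs (HasProjectiveDimensionLT (ModuleCat.of R (Fin n → R)) 2))

end IsRegularBimodule

end ProjectiveDimension

/-! ### Exactness and reflexivity of the standard duality -/

section StandardDuality

namespace StdDual

variable {K A : Type u} [Field K] [Ring A] [Algebra K A]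

/-- A functional in the standard dual as a linear map. -/
abbrev app {M : Type u} [AddCommGroup M] [Module K M] (f : StdDual K M) : M →ₗ[K] K := f

section Vector

variable {M N L : Type u} [AddCommGroup M] [Module K M] [AddCommGroup N] [Module K N]
  [AddCommGroup L] [Module K L]

@[ext]
theorem ext {f g : StdDual K M} (h : ∀ x, f.app x = g.app x) : f = g := LinearMap.ext h

end Vector

section Flip

variable {M N L P X : Type u} [AddCommGroup M] [AddCommGroup N] [AddCommGroup L]
  [Module K M] [Module K N] [Module K L]
  [AddCommGroup P] [Module K P] [Module Aᵐᵒᵖ P] [IsScalarTower K Aᵐᵒᵖ P]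
  [AddCommGroup X] [Module K X] [Module A X] [IsScalarTower K A X]

/-- The adjunction of the standard duality with itself: a map `X → D P` of left modules is the
same as a bilinear form on `X × P`, and so is a map `P → D X` of right modules. -/
def flip : (X →ₗ[A] StdDual K P) ≃+ (P →ₗ[Aᵐᵒᵖ] StdDual K X) where
  toFun g :=
    { toFun := fun p =>
        { toFun := fun x => (g x).app p
          map_add' := fun x y => by rw [map_add]; rfl
          map_smul' := fun k x => by
            rw [← algebraMap_smul A k x, map_smul, algebraMap_smul]; rfl }
      map_add' := fun p q => StdDual.ext fun x => map_add (g x).app p q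
      map_smul' := fun a p => StdDual.ext fun x =>
        (congrArg (fun h : StdDual K P => h.app p) (map_smul g (unop a) x)).symm }
  invFun h :=
    { toFun := fun x =>
        { toFun := fun p => (h p).app x
          map_add' := fun x y => by rw [map_add]; rfl
          map_smul' := fun k p => by
            rw [← algebraMap_smul Aᵐᵒᵖ k p, map_smul, algebraMap_smul]; rfl }
      map_add' := fun x y => StdDual.ext fun p => map_add (h p).app x y
      map_smul' := fun a x => StdDual.ext fun p =>
        (congrArg (fun g : StdDual K X => g.app x) (map_smul h (op a) p)).symm }
  left_inv _ := rfl
  right_inv _ := rfl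
  map_add' _ _ := rfl

theorem bijective_eval [Module.Finite K M] :
    Function.Bijective fun (x : M) => (show StdDual K (StdDual K M) from
      Module.Dual.eval K M x) :=
  (Module.evalEquiv K M).bijective

variable (K A) in
/-- Reflexivity of finite-dimensional left modules. -/
noncomputable def evalLeft (X : Type u) [AddCommGroup X] [Module K X] [Module A X]
    [IsScalarTower K A X] [Module.Finite K X] : X ≃ₗ[A] StdDual K (StdDual K X) :=
  LinearEquiv.ofBijective (flip.symm (LinearMap.id : StdDual K X →ₗ[Aᵐᵒᵖ] StdDual K X))
    bijective_eval

variable (K A) in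
/-- Reflexivity of finite-dimensional right modules. -/
noncomputable def evalRight (P : Type u) [AddCommGroup P] [Module K P] [Module Aᵐᵒᵖ P]
    [IsScalarTower K Aᵐᵒᵖ P] [Module.Finite K P] : P ≃ₗ[Aᵐᵒᵖ] StdDual K (StdDual K P) :=
  LinearEquiv.ofBijective (flip (LinearMap.id : StdDual K P →ₗ[A] StdDual K P))
    bijective_eval

section Map

variable [Module A M] [IsScalarTower K A M] [Module A N] [IsScalarTower K A N]
  [Module A L] [IsScalarTower K A L]

variable (K) in
/-- The dual of a map of left modules. -/
def mapLeft (f : M →ₗ[A] N) : StdDual K N →ₗ[Aᵐᵒᵖ] StdDual K M :=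
  flip (flip.symm (LinearMap.id : StdDual K N →ₗ[Aᵐᵒᵖ] StdDual K N) ∘ₗ f)

theorem mapLeft_apply (f : M →ₗ[A] N) (φ : StdDual K N) (x : M) :
    (mapLeft K f φ).app x = φ.app (f x) := rfl

theorem mapLeft_injective {f : M →ₗ[A] N} (hf : Function.Surjective f) :
    Function.Injective (mapLeft K f) :=
  LinearMap.dualMap_injective_of_surjective (f := f.restrictScalars K) hf

theorem mapLeft_surjective {f : M →ₗ[A] N} (hf : Function.Injective f) :
    Function.Surjective (mapLeft K f) :=
  LinearMap.dualMap_surjective_of_injective (f := f.restrictScalars K) hf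

theorem mapLeft_exact {f : M →ₗ[A] N} {g : N →ₗ[A] L} (h : Function.Exact f g)
    (hg : Function.Surjective g) : Function.Exact (mapLeft K g) (mapLeft K f) := by
  refine fun φ => ⟨fun hφ => ?_, ?_⟩
  · obtain ⟨χ, hχ⟩ := exists_comp_eq_of_ker_le (g := g.restrictScalars K) hg (a := φ.app)
      fun x hx => by
        obtain ⟨y, rfl⟩ := (h x).1 hx
        exact congrArg (fun ξ : StdDual K M => ξ.app y) hφ
    exact ⟨χ, hχ⟩
  · rintro ⟨χ, rfl⟩
    refine StdDual.ext fun x => ?_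
    rw [mapLeft_apply, mapLeft_apply, h.apply_apply_eq_zero, map_zero]
    rfl

end Map

section Map'

variable [Module Aᵐᵒᵖ M] [IsScalarTower K Aᵐᵒᵖ M] [Module Aᵐᵒᵖ N] [IsScalarTower K Aᵐᵒᵖ N]
  [Module Aᵐᵒᵖ L] [IsScalarTower K Aᵐᵒᵖ L]

variable (K) in
/-- The dual of a map of right modules. -/
def mapRight (f : M →ₗ[Aᵐᵒᵖ] N) : StdDual K N →ₗ[A] StdDual K M :=
  flip.symm (flip (LinearMap.id : StdDual K N →ₗ[A] StdDual K N) ∘ₗ f)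

theorem mapRight_apply (f : M →ₗ[Aᵐᵒᵖ] N) (φ : StdDual K N) (x : M) :
    (mapRight K f φ).app x = φ.app (f x) := rfl

theorem mapRight_injective {f : M →ₗ[Aᵐᵒᵖ] N} (hf : Function.Surjective f) :
    Function.Injective (mapRight K f) :=
  LinearMap.dualMap_injective_of_surjective (f := f.restrictScalars K) hf

theorem mapRight_surjective {f : M →ₗ[Aᵐᵒᵖ] N} (hf : Function.Injective f) :
    Function.Surjective (mapRight K f) :=
  LinearMap.dualMap_surjective_of_injective (f := f.restrictScalars K) hf

theorem mapRight_exact {f : M →ₗ[Aᵐᵒᵖ] N} {g : N →ₗ[Aᵐᵒᵖ] L} (h : Function.Exact f g)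
    (hg : Function.Surjective g) : Function.Exact (mapRight K g) (mapRight K f) := by
  refine fun φ => ⟨fun hφ => ?_, ?_⟩
  · obtain ⟨χ, hχ⟩ := exists_comp_eq_of_ker_le (g := g.restrictScalars K) hg (a := φ.app)
      fun x hx => by
        obtain ⟨y, rfl⟩ := (h x).1 hx
        exact congrArg (fun ξ : StdDual K M => ξ.app y) hφ
    exact ⟨χ, hχ⟩
  · rintro ⟨χ, rfl⟩
    refine StdDual.ext fun x => ?_
    rw [mapRight_apply, mapRight_apply, h.apply_apply_eq_zero, map_zero]
    rfl

end Map'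

/-- The dual of a projective right module is an injective left module. -/
theorem injective_left [Module.Projective Aᵐᵒᵖ P] : Module.Injective A (StdDual K P) where
  out X Y _ _ _ _ f hf g := by
    let := Module.restrictScalars K A X
    let := Module.restrictScalars K A Y
    have := IsScalarTower.restrictScalars K A X
    have := IsScalarTower.restrictScalars K A Y
    obtain ⟨h, hh⟩ := Module.projective_lifting_property (mapLeft K f) (flip g)
      (mapLeft_surjective hf)
    refine ⟨flip.symm h, fun x => StdDual.ext fun p => ?_⟩
    exact congrArg (fun φ : StdDual K X => φ.app x) (LinearMap.congr_fun hh p)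

/-- The dual of a projective left module is an injective right module. -/
theorem injective_right [Module.Projective A X] : Module.Injective Aᵐᵒᵖ (StdDual K X) where
  out M N _ _ _ _ f hf g := by
    let := Module.restrictScalars K Aᵐᵒᵖ M
    let := Module.restrictScalars K Aᵐᵒᵖ N
    have := IsScalarTower.restrictScalars K Aᵐᵒᵖ M
    have := IsScalarTower.restrictScalars K Aᵐᵒᵖ N
    obtain ⟨h, hh⟩ := Module.projective_lifting_property (mapRight K f) (flip.symm g)
      (mapRight_surjective hf)
    refine ⟨flip h, fun m => StdDual.ext fun x => ?_⟩
    exact congrArg (fun φ : StdDual K M => φ.app m) (LinearMap.congr_fun hh x)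

/-- A finite-dimensional right module embeds into a finite sum of copies of `D A`. -/
theorem exists_embedding [Module.Finite K P] :
    ∃ (n : ℕ) (e : P →ₗ[Aᵐᵒᵖ] (Fin n → StdDual K A)), Function.Injective e := by
  let b := Module.finBasis K (Module.Dual K P)
  -- a functional `φ` on `P` corresponds to the map `p ↦ (a ↦ φ (p · a))` into `D A`
  let c : Module.Dual K P → (P →ₗ[Aᵐᵒᵖ] StdDual K A) := fun φ =>
    flip (LinearMap.toSpanSingleton A (StdDual K P) φ)
  have hc : ∀ φ p, (c φ p).app 1 = φ p := fun φ p =>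
    congrArg (fun ξ : StdDual K P => ξ.app p) (one_smul A (show StdDual K P from φ))
  refine ⟨_, LinearMap.pi fun i => c (b i), (injective_iff_map_eq_zero _).2 fun p hp => ?_⟩
  have hb : Module.Dual.eval K P p = 0 := b.ext fun i => by
    rw [Module.Dual.eval_apply, ← hc, show c (b i) p = 0 from congrFun hp i]
    rfl
  exact (Module.forall_dual_apply_eq_zero_iff K p).1 fun φ => LinearMap.congr_fun hb φ

end Flip

end StdDual

end StandardDuality

/-! ### The standard duality and homological dimensions -/

section DualDimension

variable {K A : Type u} [Field K] [Ring A] [Algebra K A] {M : Type u} [AddCommGroup M] [Module K M]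

theorem projective_ker_of_hasProjectiveDimensionLT_two {R M Q : Type u} [Ring R]
    [AddCommGroup M] [Module R M] [AddCommGroup Q] [Module R Q] [Module.Projective R Q]
    (hM : HasProjectiveDimensionLT (ModuleCat.of R M) 2) {q : Q →ₗ[R] M}
    (hq : Function.Surjective q) : Module.Projective R (LinearMap.ker q) := by
  have h : Function.Exact (LinearMap.ker q).subtype q := by
    rw [LinearMap.exact_iff, Submodule.range_subtype]
  have := (shortExact_shortComplexOf (LinearMap.ker q).subtype_injective h
    hq).hasProjectiveDimensionLT_X₁ 1
      (inferInstanceAs (HasProjectiveDimensionLT (ModuleCat.of R Q) 1)) hM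
  rw [IsProjective.iff_projective]
  exact projective_iff_hasProjectiveDimensionLT_one.2 this

theorem hasInjectiveDimensionLT_two_of_exact {R M I J : Type u} [Ring R]
    [AddCommGroup M] [Module R M] [AddCommGroup I] [Module R I] [AddCommGroup J] [Module R J]
    [Module.Injective R I] [Module.Injective R J] {f : M →ₗ[R] I} {g : I →ₗ[R] J}
    (hf : Function.Injective f) (h : Function.Exact f g) (hg : Function.Surjective g) :
    HasInjectiveDimensionLT (ModuleCat.of R M) 2 := by
  have := Module.injective_object_of_injective_module R I
  have := Module.injective_object_of_injective_module R J
  exact (shortExact_shortComplexOf hf h hg).hasInjectiveDimensionLT_X₁ 1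
    (inferInstanceAs (HasInjectiveDimensionLT (ModuleCat.of R J) 1))
    (inferInstanceAs (HasInjectiveDimensionLT (ModuleCat.of R I) 2))

theorem hasInjectiveDimensionLT_two_dual_left [Module Aᵐᵒᵖ M] [IsScalarTower K Aᵐᵒᵖ M]
    (hM : HasProjectiveDimensionLT (ModuleCat.of Aᵐᵒᵖ M) 2) [Module.Finite Aᵐᵒᵖ M] :
    HasInjectiveDimensionLT (ModuleCat.of A (StdDual K M)) 2 := by
  obtain ⟨n, q, hq⟩ := Module.Finite.exists_fin' Aᵐᵒᵖ M
  have := projective_ker_of_hasProjectiveDimensionLT_two hM hq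
  have := StdDual.injective_left (K := K) (A := A) (P := Fin n → Aᵐᵒᵖ)
  have := StdDual.injective_left (K := K) (A := A) (P := LinearMap.ker q)
  exact hasInjectiveDimensionLT_two_of_exact (StdDual.mapRight_injective (K := K) hq)
    (StdDual.mapRight_exact (f := (LinearMap.ker q).subtype)
      (by rw [LinearMap.exact_iff, Submodule.range_subtype]) hq)
    (StdDual.mapRight_surjective (LinearMap.ker q).subtype_injective)

theorem hasInjectiveDimensionLT_two_dual_right [Module A M] [IsScalarTower K A M]
    (hM : HasProjectiveDimensionLT (ModuleCat.of A M) 2) [Module.Finite A M] :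
    HasInjectiveDimensionLT (ModuleCat.of Aᵐᵒᵖ (StdDual K M)) 2 := by
  obtain ⟨n, q, hq⟩ := Module.Finite.exists_fin' A M
  have := projective_ker_of_hasProjectiveDimensionLT_two hM hq
  have := StdDual.injective_right (K := K) (A := A) (X := Fin n → A)
  have := StdDual.injective_right (K := K) (A := A) (X := LinearMap.ker q)
  exact hasInjectiveDimensionLT_two_of_exact (StdDual.mapLeft_injective (K := K) hq)
    (StdDual.mapLeft_exact (f := (LinearMap.ker q).subtype)
      (by rw [LinearMap.exact_iff, Submodule.range_subtype]) hq)
    (StdDual.mapLeft_surjective (LinearMap.ker q).subtype_injective)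

end DualDimension

/-! ### The standard duality and Grothendieck groups -/

section Rank

open Classical in
/-- A duality from `mod S` onto `mod R` bounds the rank of the Grothendieck group of `mod R`. -/
theorem finrank_additiveFunction_le {R S : Type u} [Ring R] [Ring S] [IsArtinianRing S]
    (D : ModuleCat.{u} S → ModuleCat.{u} R)
    (hfin : ∀ X : ModuleCat.{u} S, Module.Finite S X → Module.Finite R (D X))
    (hexact : ∀ (M N L : ModuleCat.{u} S) (f : M →ₗ[S] N) (g : N →ₗ[S] L),
      Function.Injective f → Function.Exact f g → Function.Surjective g →
        ∃ (g' : D L →ₗ[R] D N) (f' : D N →ₗ[R] D M),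
          Function.Injective g' ∧ Function.Exact g' f' ∧ Function.Surjective f')
    (hsurj : ∀ Y : ModuleCat.{u} R, Module.Finite R Y →
      ∃ X : ModuleCat.{u} S, Module.Finite S X ∧ Nonempty (Y ≃ₗ[R] D X)) :
    Module.finrank ℚ (AdditiveFunction R) ≤ Module.finrank ℚ (AdditiveFunction S) := by
  let F : AdditiveFunction R →ₗ[ℚ] AdditiveFunction S :=
    { toFun := fun ψ => ⟨fun X => if Module.Finite S X then ψ.1 (D X) else 0,
        fun X hX => if_neg hX, fun M N L f g h₁ h₂ h₃ hf h hg => by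
          obtain ⟨g', f', hg', h', hf'⟩ := hexact M N L f g hf h hg
          simp only [if_pos h₁, if_pos h₂, if_pos h₃]
          rw [add_comm]
          exact ψ.2.2 _ _ _ g' f' (hfin L h₃) (hfin N h₂) (hfin M h₁) hg' h' hf'⟩
      map_add' := fun φ ψ => by
        refine Subtype.ext (funext fun X => ?_)
        by_cases hX : Module.Finite S X <;> simp [hX]
      map_smul' := fun c ψ => by
        refine Subtype.ext (funext fun X => ?_)
        by_cases hX : Module.Finite S X <;> simp [hX] }
  refine LinearMap.finrank_le_finrank_of_injective (f := F)
    ((injective_iff_map_eq_zero F).2 fun ψ hψ => AdditiveFunction.ext_of_eval _ _ fun Y _ _ hY => ?_)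
  obtain ⟨X, hX, ⟨e⟩⟩ := hsurj (ModuleCat.of R Y) hY
  have h : (if Module.Finite S X then ψ.1 (D X) else 0) = 0 :=
    congrFun (congrArg Subtype.val hψ) X
  rw [if_pos hX] at h
  exact (ψ.eval_congr e).trans h

/-- Reflexivity of finite-dimensional right modules, for any compatible vector space structure
on the dual. -/
theorem nonempty_equiv_bidual_right {K A : Type u} [Field K] [Ring A] [Algebra K A] (P : Type u)
    [AddCommGroup P] [Module K P] [Module Aᵐᵒᵖ P] [IsScalarTower K Aᵐᵒᵖ P] [Module.Finite K P]
    (m : Module K (StdDual K P)) (hm : IsScalarTower K A (StdDual K P)) :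
    Nonempty (P ≃ₗ[Aᵐᵒᵖ] @StdDual K (StdDual K P) _ _ m) := by
  obtain rfl : m = instModuleStdDual := Module.ext' _ _ fun k f => by
    exact (@algebraMap_smul K _ A _ _ (StdDual K P) _ _ m hm k f).symm.trans
      (@algebraMap_smul K _ A _ _ (StdDual K P) _ _ instModuleStdDual _ k f)
  exact ⟨StdDual.evalRight K A P⟩

/-- Reflexivity of finite-dimensional left modules, for any compatible vector space structure
on the dual. -/
theorem nonempty_equiv_bidual_left {K A : Type u} [Field K] [Ring A] [Algebra K A] (P : Type u)
    [AddCommGroup P] [Module K P] [Module A P] [IsScalarTower K A P] [Module.Finite K P]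
    (m : Module K (StdDual K P)) (hm : IsScalarTower K Aᵐᵒᵖ (StdDual K P)) :
    Nonempty (P ≃ₗ[A] @StdDual K (StdDual K P) _ _ m) := by
  obtain rfl : m = instModuleStdDual := Module.ext' _ _ fun k f => by
    exact (@algebraMap_smul K _ Aᵐᵒᵖ _ _ (StdDual K P) _ _ m hm k f).symm.trans
      (@algebraMap_smul K _ Aᵐᵒᵖ _ _ (StdDual K P) _ _ instModuleStdDual _ k f)
  exact ⟨StdDual.evalLeft K A P⟩

variable (K A : Type u) [Field K] [Ring A] [Algebra K A] [Module.Finite K A]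

include K

theorem finrank_additiveFunction_right_le [IsArtinianRing A] :
    Module.finrank ℚ (AdditiveFunction Aᵐᵒᵖ) ≤ Module.finrank ℚ (AdditiveFunction A) := by
  let := fun X : ModuleCat.{u} A => ModuleCat.moduleOfAlgebraModule (k := K) X
  have htower := fun X : ModuleCat.{u} A =>
    ModuleCat.isScalarTower_of_algebra_moduleCat (k := K) X
  refine finrank_additiveFunction_le (fun X => ModuleCat.of Aᵐᵒᵖ (StdDual K X))
    (fun X _ => StdDual.finite_right K A X)
    (fun M N L f g hf h hg => ⟨StdDual.mapLeft K g, StdDual.mapLeft K f,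
      StdDual.mapLeft_injective hg, StdDual.mapLeft_exact h hg, StdDual.mapLeft_surjective hf⟩)
    fun Y _ => ?_
  let := Module.restrictScalars K Aᵐᵒᵖ Y
  have := IsScalarTower.restrictScalars K Aᵐᵒᵖ Y
  have : Module.Finite K Y := Module.Finite.trans Aᵐᵒᵖ Y
  exact ⟨ModuleCat.of A (StdDual K Y), StdDual.finite_left K A Y,
    nonempty_equiv_bidual_right Y _ (htower (ModuleCat.of A (StdDual K Y)))⟩

theorem finrank_additiveFunction_left_le [IsArtinianRing Aᵐᵒᵖ] :
    Module.finrank ℚ (AdditiveFunction A) ≤ Module.finrank ℚ (AdditiveFunction Aᵐᵒᵖ) := by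
  let := fun X : ModuleCat.{u} Aᵐᵒᵖ => ModuleCat.moduleOfAlgebraModule (k := K) X
  have htower := fun X : ModuleCat.{u} Aᵐᵒᵖ =>
    ModuleCat.isScalarTower_of_algebra_moduleCat (k := K) X
  refine finrank_additiveFunction_le (fun X => ModuleCat.of A (StdDual K X))
    (fun X _ => StdDual.finite_left K A X)
    (fun M N L f g hf h hg => ⟨StdDual.mapRight K g, StdDual.mapRight K f,
      StdDual.mapRight_injective hg, StdDual.mapRight_exact h hg, StdDual.mapRight_surjective hf⟩)
    fun Y _ => ?_
  let := Module.restrictScalars K A Y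
  have := IsScalarTower.restrictScalars K A Y
  have : Module.Finite K Y := Module.Finite.trans A Y
  exact ⟨ModuleCat.of Aᵐᵒᵖ (StdDual K Y), StdDual.finite_right K A Y,
    nonempty_equiv_bidual_left Y _ (htower (ModuleCat.of Aᵐᵒᵖ (StdDual K Y)))⟩

end Rank

/-! ### Rigidity and projective dimension -/

section Rigid

/-- A module has projective dimension at most one if and only if the differential of its minimal
projective presentation is injective. -/
theorem MinProjPresentation.hasProjectiveDimensionLT_two_iff {R M : Type u} [Ring R]
    [AddCommGroup M] [Module R M] (p : MinProjPresentation R M) :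
    HasProjectiveDimensionLT (ModuleCat.of R M) 2 ↔ LinearMap.ker p.d = ⊥ := by
  have := p.cover₀.projective
  have := p.cover₁.projective
  have hd : LinearMap.ker p.d = LinearMap.ker p.π₁ :=
    LinearMap.ker_comp_of_ker_eq_bot p.π₁ (Submodule.ker_subtype _)
  rw [hd]
  have hexact : Function.Exact (LinearMap.ker p.π₀).subtype p.π₀ := by
    rw [LinearMap.exact_iff, Submodule.range_subtype]
  constructor
  · intro h
    have := projective_ker_of_hasProjectiveDimensionLT_two h p.cover₀.surjective
    -- a section of `π₁` is onto, because `Ker π₁` is superfluous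
    obtain ⟨s, hs⟩ := p.π₁.exists_rightInverse_of_surjective
      (LinearMap.range_eq_top.2 p.cover₁.surjective)
    have hs' : ∀ x, p.π₁ (s x) = x := LinearMap.congr_fun hs
    have htop : LinearMap.range s = ⊤ := by
      refine p.cover₁.superfluous _ (eq_top_iff.2 fun x _ => ?_)
      rw [show x = s (p.π₁ x) + (x - s (p.π₁ x)) by abel]
      exact Submodule.add_mem_sup ⟨_, rfl⟩ (by simp [hs'])
    rw [eq_bot_iff]
    intro x hx
    obtain ⟨y, rfl⟩ := LinearMap.range_eq_top.1 htop x
    have hy : y = 0 := (hs' y).symm.trans hx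
    rw [hy, map_zero]
    exact Submodule.zero_mem _
  · intro h
    have hK : Module.Projective R (LinearMap.ker p.π₀) :=
      Module.Projective.of_equiv (LinearEquiv.ofBijective p.π₁
        ⟨LinearMap.ker_eq_bot.1 h, p.cover₁.surjective⟩)
    exact (shortExact_shortComplexOf (LinearMap.ker p.π₀).subtype_injective hexact
      p.cover₀.surjective).hasProjectiveDimensionLT_X₃ 1
        (inferInstanceAs (HasProjectiveDimensionLT (ModuleCat.of R (LinearMap.ker p.π₀)) 1))
        (inferInstanceAs (HasProjectiveDimensionLT (ModuleCat.of R p.P₀) 2))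

/-- The dual of the transpose of `M` vanishes exactly if `M` has projective dimension at most
one. -/
theorem IsRegularBimodule.forall_hom_coker_eq_zero_iff {R S U M : Type u} [Ring R] [Ring S]
    [AddCommGroup U] [Module R U] [Module S U] [SMulCommClass R S U] [SMulCommClass S R U] {u : U}
    (hU : IsRegularBimodule R S U u) [AddCommGroup M] [Module S M]
    (p : MinProjPresentation S M) :
    (∀ f : ((p.P₁ →ₗ[S] U) ⧸ LinearMap.range (LinearMap.lcomp R U p.d)) →ₗ[R] U, f = 0) ↔
      HasProjectiveDimensionLT (ModuleCat.of S M) 2 := by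
  have := p.cover₀.projective
  have := p.cover₀.finite
  have := p.cover₁.projective
  have := p.cover₁.finite
  rw [p.hasProjectiveDimensionLT_two_iff, ← Submodule.subsingleton_iff_eq_bot]
  constructor
  · intro h
    have := subsingleton_of_forall_eq _ h
    exact (hU.kerEquivHomCoker p.d).toEquiv.subsingleton
  · intro h f
    have := (hU.kerEquivHomCoker p.d).symm.toEquiv.subsingleton
    exact Subsingleton.elim _ _

theorem isRegularBimodule (A : Type u) [Ring A] : IsRegularBimodule A Aᵐᵒᵖ A (1 : A) where
  bijective_left := ⟨fun a b h => by simpa using h, fun a => ⟨a, by simp⟩⟩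
  bijective_right :=
    ⟨fun a b h => unop_injective (by simpa using h), fun a => ⟨op a, by simp⟩⟩

variable (K A : Type u) [Field K] [Ring A] [Algebra K A] [Module.Finite K A]

theorem isTauInvRigid_regular_iff :
    IsTauInvRigid K A A ↔ HasProjectiveDimensionLT (ModuleCat.of A (StdDual K A)) 2 :=
  haveI : IsArtinianRing A := IsArtinianRing.of_finite K A
  (isRegularBimodule A).symm.forall_hom_coker_eq_zero_iff (minPres A (StdDual K A))

/-- By the adjunction of the duality with itself, `Hom(D A, τ D A) = Hom(Tr D A, A)`. -/
theorem isTauRigid_dual_iff :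
    IsTauRigid K A (StdDual K A) ↔
      HasProjectiveDimensionLT (ModuleCat.of Aᵐᵒᵖ (StdDual K A)) 2 := by
  have : IsArtinianRing Aᵐᵒᵖ := IsArtinianRing.of_finite K Aᵐᵒᵖ
  rw [← (isRegularBimodule A).forall_hom_coker_eq_zero_iff (minPres Aᵐᵒᵖ (StdDual K A))]
  let e := StdDual.evalLeft K A A
  constructor
  · intro h f
    have h0 := h (StdDual.flip (e.toLinearMap ∘ₗ f))
    have h1 : e.toLinearMap ∘ₗ f = 0 :=
      StdDual.flip.injective (h0.trans (map_zero StdDual.flip).symm)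
    ext x
    exact e.injective ((LinearMap.congr_fun h1 _).trans (map_zero e).symm)
  · intro h f
    have h0 := h (e.symm.toLinearMap ∘ₗ StdDual.flip.symm f)
    have h1 : StdDual.flip.symm f = 0 := LinearMap.ext fun x =>
      e.symm.injective ((LinearMap.congr_fun h0 x).trans (map_zero e.symm).symm)
    exact StdDual.flip.symm.injective (h1.trans (map_zero StdDual.flip.symm).symm)

end Rigid

/-! ### Symmetry of the injective dimension of the regular module -/

section Symmetry

variable (K A : Type u) [Field K] [Ring A] [Algebra K A] [Module.Finite K A]

include K in
theorem hasProjectiveDimensionLT_two_of_injective_right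
    (hid : HasInjectiveDimensionLT (ModuleCat.of Aᵐᵒᵖ A) 2) (I : Type u) [AddCommGroup I]
    [Module Aᵐᵒᵖ I] [Module.Finite Aᵐᵒᵖ I] [Module.Injective Aᵐᵒᵖ I] :
    HasProjectiveDimensionLT (ModuleCat.of Aᵐᵒᵖ I) 2 :=
  haveI : IsArtinianRing A := IsArtinianRing.of_finite K A
  haveI : IsArtinianRing Aᵐᵒᵖ := IsArtinianRing.of_finite K Aᵐᵒᵖ
  (isRegularBimodule A).symm.hasProjectiveDimensionLT_two_of_injective hid
    (finrank_additiveFunction_right_le K A)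

include K in
theorem hasProjectiveDimensionLT_two_of_injective_left
    (hid : HasInjectiveDimensionLT (ModuleCat.of A A) 2) (I : Type u) [AddCommGroup I]
    [Module A I] [Module.Finite A I] [Module.Injective A I] :
    HasProjectiveDimensionLT (ModuleCat.of A I) 2 :=
  haveI : IsArtinianRing A := IsArtinianRing.of_finite K A
  haveI : IsArtinianRing Aᵐᵒᵖ := IsArtinianRing.of_finite K Aᵐᵒᵖ
  (isRegularBimodule A).hasProjectiveDimensionLT_two_of_injective hid
    (finrank_additiveFunction_left_le K A)

theorem hasInjectiveDimensionLT_regular_left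
    (h : HasProjectiveDimensionLT (ModuleCat.of Aᵐᵒᵖ (StdDual K A)) 2) :
    HasInjectiveDimensionLT (ModuleCat.of A A) 2 :=
  haveI := hasInjectiveDimensionLT_two_dual_left (K := K) h
  hasInjectiveDimensionLT_of_iso (StdDual.evalLeft K A A).toModuleIso.symm 2

theorem hasInjectiveDimensionLT_regular_right
    (h : HasProjectiveDimensionLT (ModuleCat.of A (StdDual K A)) 2) :
    HasInjectiveDimensionLT (ModuleCat.of Aᵐᵒᵖ A) 2 :=
  haveI := hasInjectiveDimensionLT_two_dual_right (K := K) h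
  hasInjectiveDimensionLT_of_iso (StdDual.evalRight K A A).toModuleIso.symm 2

theorem hasProjectiveDimensionLT_dual_right
    (hid : HasInjectiveDimensionLT (ModuleCat.of Aᵐᵒᵖ A) 2) :
    HasProjectiveDimensionLT (ModuleCat.of Aᵐᵒᵖ (StdDual K A)) 2 :=
  haveI := StdDual.injective_right (K := K) (A := A) (X := A)
  hasProjectiveDimensionLT_two_of_injective_right K A hid _

theorem hasProjectiveDimensionLT_dual_left
    (hid : HasInjectiveDimensionLT (ModuleCat.of A A) 2) :
    HasProjectiveDimensionLT (ModuleCat.of A (StdDual K A)) 2 :=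
  haveI := (isRegularBimodule A).symm.projective
  haveI := StdDual.injective_left (K := K) (A := A) (P := A)
  hasProjectiveDimensionLT_two_of_injective_left K A hid _

end Symmetry

/-! ### Cotilting modules over Iwanaga-Gorenstein algebras -/

section Cotilting

variable {K A : Type u} [Field K] [Ring A] [Algebra K A] [Module.Finite K A]

/-- The dual `D A` is a classical cotilting module. -/
theorem isClassicalCotilting_dual : IsClassicalCotilting K A (ModuleCat.of Aᵐᵒᵖ (StdDual K A)) := by
  have hinj := StdDual.injective_right (K := K) (A := A) (X := A)
  have := Module.injective_object_of_injective_module Aᵐᵒᵖ (StdDual K A)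
  refine ⟨StdDual.finite_right K A A, ?_, fun i hi => ?_, ?_⟩
  · exact (injectiveDimension_le_iff _ 1).2 inferInstance
  · obtain ⟨j, rfl⟩ : ∃ j, i = j + 1 := ⟨i - 1, by omega⟩
    exact extVanish_of_injective j
  · refine ⟨ModuleCat.of Aᵐᵒᵖ (StdDual K A), ModuleCat.of Aᵐᵒᵖ PUnit, 0, LinearMap.id,
      ⟨1, LinearMap.pi fun _ => LinearMap.id, LinearMap.proj 0, rfl⟩,
      ⟨0, 0, 0, Subsingleton.elim _ _⟩, fun _ _ _ => Subsingleton.elim _ _, fun x => ?_,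
      Function.surjective_id⟩
    exact ⟨fun hx => ⟨0, hx.symm⟩, by rintro ⟨_, rfl⟩; rfl⟩

theorem extVanish_of_inAdd {R Z : Type u} [Ring R] [AddCommGroup Z] [Module R Z]
    {T X : ModuleCat.{u} R} (hX : InAdd T X) (n : ℕ) (hT : ExtVanish R Z T n) :
    ExtVanish R Z X n := by
  obtain ⟨k, i, r, hri⟩ := hX
  exact extVanish_of_retract' n i r hri (extVanish_pi' n hT k)

/-- If `T` is cotilting and `Ext¹(X, T) = 0`, then a left approximation `X → Tʳ` is injective and
its cokernel again satisfies `Ext¹(-, T) = 0`. -/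
theorem IsClassicalCotilting.exists_embedding {T : ModuleCat.{u} Aᵐᵒᵖ}
    (hT : IsClassicalCotilting K A T) (X : Type u) [AddCommGroup X] [Module Aᵐᵒᵖ X]
    [Module.Finite Aᵐᵒᵖ X] (hX : ExtVanish Aᵐᵒᵖ X T 1) :
    ∃ (r : ℕ) (a : X →ₗ[Aᵐᵒᵖ] (Fin r → T)), Function.Injective a ∧
      ExtVanish Aᵐᵒᵖ ((Fin r → T) ⧸ LinearMap.range a) T 1 := by
  have := hT.finite
  let := Module.restrictScalars K Aᵐᵒᵖ X
  have := IsScalarTower.restrictScalars K Aᵐᵒᵖ X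
  let := Module.restrictScalars K Aᵐᵒᵖ T
  have := IsScalarTower.restrictScalars K Aᵐᵒᵖ T
  have : Module.Finite K X := Module.Finite.trans Aᵐᵒᵖ X
  have : Module.Finite K T := Module.Finite.trans Aᵐᵒᵖ T
  have : Module.Finite K (X →ₗ[Aᵐᵒᵖ] T) :=
    Module.Finite.of_injective (LinearMap.restrictScalarsₗ K Aᵐᵒᵖ X T K)
      (LinearMap.restrictScalars_injective K)
  obtain ⟨r, x, hx⟩ := Module.Finite.exists_fin (R := K) (M := X →ₗ[Aᵐᵒᵖ] T)
  let a : X →ₗ[Aᵐᵒᵖ] (Fin r → T) := LinearMap.pi x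
  have ha : ∀ h : X →ₗ[Aᵐᵒᵖ] T, ∃ b : (Fin r → T) →ₗ[Aᵐᵒᵖ] T, b ∘ₗ a = h := by
    intro h
    obtain ⟨c, hc⟩ := (Submodule.mem_span_range_iff_exists_fun K).1
      (hx.symm ▸ Submodule.mem_top : h ∈ Submodule.span K (Set.range x))
    refine ⟨∑ i, c i • LinearMap.proj i, ?_⟩
    rw [← hc]
    ext m
    simp [LinearMap.sum_apply, a]
  have hinj : Function.Injective a := by
    obtain ⟨T₀, T₁, f, g, ⟨n, i, ρ, hρ⟩, h₁, hf, hfg, hg⟩ := hT.resolution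
    obtain ⟨k, e, he⟩ := StdDual.exists_embedding (K := K) (A := A) (P := X)
    refine (injective_iff_map_eq_zero a).2 fun y hy => he ?_
    have hzero : ∀ h : X →ₗ[Aᵐᵒᵖ] T, h y = 0 := fun h => by
      obtain ⟨b, rfl⟩ := ha h
      rw [LinearMap.comp_apply, hy, map_zero]
    rw [map_zero]
    funext j
    obtain ⟨b, hb⟩ := exists_lift_of_extVanish hf hfg hg (extVanish_of_inAdd h₁ 1 hX)
      (LinearMap.proj j ∘ₗ e)
    have hiy : i (b y) = 0 := funext fun l => hzero (LinearMap.proj l ∘ₗ i ∘ₗ b)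
    have hby : b y = 0 := by rw [← LinearMap.id_apply (R := Aᵐᵒᵖ) (b y), ← hρ,
      LinearMap.comp_apply, hiy, map_zero]
    exact (LinearMap.congr_fun hb y).symm.trans (by rw [LinearMap.comp_apply, hby, map_zero]; rfl)
  exact ⟨r, a, hinj, extVanish_one_of_exists_extend hinj (LinearMap.exact_map_mkQ_range a)
    (Submodule.mkQ_surjective _) (extVanish_pi 1 (hT.ext_eq_zero 1 le_rfl) r) ha⟩

/-- If `A` has right injective dimension at most one, classical cotilting modules are classical
tilting: two left `T`-approximations give the coresolution of `A`. -/
theorem IsClassicalCotilting.isClassicalTilting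
    (hid : HasInjectiveDimensionLT (ModuleCat.of Aᵐᵒᵖ A) 2) {T : ModuleCat.{u} Aᵐᵒᵖ}
    (hT : IsClassicalCotilting K A T) : IsClassicalTilting A T := by
  have := hT.finite
  have : IsArtinianRing Aᵐᵒᵖ := IsArtinianRing.of_finite K Aᵐᵒᵖ
  refine ⟨hT.finite, ?_, hT.ext_eq_zero, ?_⟩
  · -- `T` has an injective coresolution of length one by modules of projective dimension `≤ 1`
    let := Module.restrictScalars K Aᵐᵒᵖ T
    have := IsScalarTower.restrictScalars K Aᵐᵒᵖ T
    have : Module.Finite K T := Module.Finite.trans Aᵐᵒᵖ T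
    obtain ⟨k, e, he⟩ := StdDual.exists_embedding (K := K) (A := A) (P := T)
    have := StdDual.injective_right (K := K) (A := A) (X := A)
    have hS := shortExact_shortComplexOf he (LinearMap.exact_map_mkQ_range e)
      (Submodule.mkQ_surjective _)
    have := Module.injective_object_of_injective_module Aᵐᵒᵖ (Fin k → StdDual K A)
    have hC := hS.hasInjectiveDimensionLT_X₃ 1
      (inferInstanceAs (HasInjectiveDimensionLT
        (ModuleCat.of Aᵐᵒᵖ (Fin k → StdDual K A)) 1))
      ((injectiveDimension_le_iff T 1).1 hT.injDim_le)
    have : Injective (ModuleCat.of Aᵐᵒᵖ ((Fin k → StdDual K A) ⧸ LinearMap.range e)) :=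
      injective_iff_hasInjectiveDimensionLT_one.2 hC
    have := Module.injective_module_of_injective_object Aᵐᵒᵖ
      ((Fin k → StdDual K A) ⧸ LinearMap.range e)
    have h₂ := hasProjectiveDimensionLT_two_of_injective_right K A hid (Fin k → StdDual K A)
    have h₃ := hasProjectiveDimensionLT_two_of_injective_right K A hid
      ((Fin k → StdDual K A) ⧸ LinearMap.range e)
    exact (projectiveDimension_le_iff T 1).2 (hS.hasProjectiveDimensionLT_X₁ 2 h₂
      (hasProjectiveDimensionLT_of_ge _ 2 3 (by norm_num)))
  · have hA : Module.Projective Aᵐᵒᵖ A := (isRegularBimodule A).symm.projective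
    obtain ⟨m, a, ha, hQ⟩ := hT.exists_embedding A (extVanish_of_projective 0)
    obtain ⟨r, b, hb, hQ'⟩ := hT.exists_embedding _ hQ
    have hsplit : ExtVanish Aᵐᵒᵖ
        ((Fin r → T) ⧸ LinearMap.range b) ((Fin m → T) ⧸ LinearMap.range a) 1 :=
      extVanish_right' ha (LinearMap.exact_map_mkQ_range a) (Submodule.mkQ_surjective _) 1
        (extVanish_pi' 1 hQ' m)
        (HasInjectiveDimensionLT.subsingleton (ModuleCat.of Aᵐᵒᵖ A) 2 2 le_rfl _)
    obtain ⟨c, hc⟩ := exists_extend_of_extVanish hb (LinearMap.exact_map_mkQ_range b)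
      (Submodule.mkQ_surjective _) hsplit LinearMap.id
    exact ⟨ModuleCat.of Aᵐᵒᵖ (Fin m → T), ModuleCat.of Aᵐᵒᵖ ((Fin m → T) ⧸ LinearMap.range a), a,
      (LinearMap.range a).mkQ, ⟨m, LinearMap.id, LinearMap.id, rfl⟩, ⟨r, b, c, hc⟩, ha,
      LinearMap.exact_map_mkQ_range a, Submodule.mkQ_surjective _⟩

end Cotilting

end TauTilting

theorem theorem0p1 (K A : Type u) [Field K] [IsAlgClosed K] [Ring A] [Algebra K A]
    [Module.Finite K A] :
    List.TFAE [
      TauTilting.IsIwanagaGorenstein A ∧ injectiveDimension (ModuleCat.of Aᵐᵒᵖ A) ≤ 1,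
      ∀ T : ModuleCat.{u} Aᵐᵒᵖ,
        TauTilting.IsClassicalCotilting K A T → TauTilting.IsClassicalTilting A T,
      TauTilting.IsTauRigid K A (TauTilting.StdDual K A),
      TauTilting.IsTauInvRigid K A A] := by
  open TauTilting in
  rw [isTauRigid_dual_iff, isTauInvRigid_regular_iff]
  tfae_have 1 → 2 := fun h T hT =>
    hT.isClassicalTilting ((injectiveDimension_le_iff _ 1).1 h.2)
  tfae_have 2 → 3 := fun h =>
    (projectiveDimension_le_iff _ 1).1 (h _ isClassicalCotilting_dual).projDim_le
  tfae_have 3 → 4 := fun h =>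
    hasProjectiveDimensionLT_dual_left K A (hasInjectiveDimensionLT_regular_left K A h)
  tfae_have 4 → 1 := fun h => by
    have hr := hasInjectiveDimensionLT_regular_right K A h
    have hl := hasInjectiveDimensionLT_regular_left K A
      (hasProjectiveDimensionLT_dual_right K A hr)
    have hr' := (injectiveDimension_le_iff (ModuleCat.of Aᵐᵒᵖ A) 1).2 hr
    have hl' := (injectiveDimension_le_iff (ModuleCat.of A A) 1).2 hl
    exact ⟨⟨hr'.trans_lt (by decide), hl'.trans_lt (by decide)⟩, hr'⟩
  tfae_finish
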